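/- Let $\mathcal{M}$ be a finite Markov decision process, i.e. a finite directed graph with state set $V$ and edge set $E\subseteq V\times V$ in which every state has a successor, whose states are partitioned into controlled states $V_C$ and probabilistic states $V_P$, and where each probabilistic state $s$ carries a probability distribution over its outgoing edges. Let a cost function $\mathrm{cost}:E\to\mathbb{Z}$ and a priority function $V\to\mathbb{N}$ be given. A strategy assigns to every finite word of states ending in a controlled state $s$ a probability distribution over the outgoing edges of $s$; a strategy $\sigma$ and an initial state $p$ induce a probability measure $\mathbb{P}^{\mathcal{M}(\sigma)}_p$ on infinite runs $s_0s_1\ldots$ from $s_0=p$. For $k\in\mathbb{N}$ let $\mathrm{EN}(k)$ be the set of runs with $k+\sum_{i=0}^{l}\mathrm{cost}(s_i,s_{i+1})\ge 0$ for all $l\in\mathbb{N}$, and let $\mathrm{Parity}$ be the set of runs on which the least priority that occurs infinitely often is even. Write $\mathrm{Val}^{\mathcal{M}}_p(O)=\sup_\sigma \mathbb{P}^{\mathcal{M}(\sigma)}_p(O)$ for the value of an objective $O$, and $\mathrm{LVal}^{\mathcal{M}}_p=\sup_{k\in\mathbb{N}}\mathrm{Val}^{\mathcal{M}}_p(\mathrm{EN}(k)\cap\mathrm{Parity})$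 for the limit value of $p$. The extension $\mathcal{M}'$ of $\mathcal{M}$ is obtained by adding, for every controlled state $s\in V_C$ with $\mathrm{LVal}^{\mathcal{M}}_s=1$, a new controlled state $s'$ of priority $0$ with edges $(s,s')$ of cost $-1$ and $(s',s)$ of cost $0$ (its only outgoing edge). **Theorem.** For every state $p$ of $\mathcal{M}$ and every $k\in\mathbb{N}$, $$\mathrm{Val}^{\mathcal{M}}_p(\mathrm{EN}(k)\cap\mathrm{Parity})=1$$ if and only if there is a strategy $\sigma$ in $\mathcal{M}'$ with $$\mathbb{P}^{\mathcal{M}'(\sigma)}_p(\mathrm{EN}(k)\cap\mathrm{Parity})=1 .$$ -/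

import Mathlib

open MeasureTheory ProbabilityTheory Filter
open scoped ENNReal

/-- A Markov decision process on the state space `V`, with a cost function on edges and a priority
function on states. States outside `controlled` are probabilistic. The relation `edge` is the set of
edges; only the values of `cost` on edges are relevant. -/
structure EnergyParityMDP (V : Type*) where
  /-- the controlled states -/
  controlled : Set V
  /-- the edges -/
  edge : V → V → Prop
  /-- every state has a successor -/
  sinkless : ∀ s, ∃ t, edge s t
  /-- the distribution over the outgoing edges of a probabilistic state, given by their targets -/
  prob : {s : V // s ∉ controlled} → PMF V
  /-- probabilistic moves follow edges -/
  prob_edge : ∀ s t, prob s t ≠ 0 → edge s t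
  /-- the cost of an edge -/
  cost : V → V → ℤ
  /-- the priority of a state -/
  priority : V → ℕ

namespace EnergyParityMDP

/-- A (history-dependent, randomized) strategy: to each history `w s`, where `w` is a finite word of
states and `s` is a controlled state, it assigns a distribution over the outgoing edges of `s`. -/
structure Strategy {V : Type*} (M : EnergyParityMDP V) where
  /-- the distribution chosen after the history `w s` -/
  choice : List V → {s : V // s ∈ M.controlled} → PMF V
  /-- chosen moves follow edges -/
  choice_edge : ∀ w s t, choice w s t ≠ 0 → M.edge s t

section Measure

variable {V : Type*} [Finite V] [MeasurableSpace V] [DiscreteMeasurableSpace V]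

open Classical in
/-- The distribution of the next state after the history `w s` when playing `σ`. -/
noncomputable def next (M : EnergyParityMDP V) (σ : M.Strategy) (w : List V) (s : V) : PMF V :=
  if hs : s ∈ M.controlled then σ.choice w ⟨s, hs⟩ else M.prob ⟨s, hs⟩

/-- The transition kernel at time `n`: from a history `h 0, …, h n` to the next state. -/
noncomputable def stepKernel (M : EnergyParityMDP V) (σ : M.Strategy) (n : ℕ) :
    Kernel (Π _ : Finset.Iic n, V) V where
  toFun h := (M.next σ (List.ofFn fun i : Fin n => h ⟨i, Finset.mem_Iic.2 i.2.le⟩)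
    (h ⟨n, Finset.mem_Iic.2 le_rfl⟩)).toMeasure
  measurable' := Measurable.of_discrete

instance (M : EnergyParityMDP V) (σ : M.Strategy) (n : ℕ) :
    IsMarkovKernel (M.stepKernel σ n) :=
  ⟨fun _ => PMF.toMeasure.isProbabilityMeasure _⟩

/-- The probability measure on infinite sequences of states that is induced by the strategy `σ`
from the initial state `p`. -/
noncomputable def runMeasure (M : EnergyParityMDP V) (σ : M.Strategy) (p : V) : Measure (ℕ → V) :=
  Kernel.traj (X := fun _ => V) (M.stepKernel σ) 0 (fun _ => p)

/-- The value of an objective from the initial state `p`. -/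
noncomputable def value (M : EnergyParityMDP V) (p : V) (O : Set (ℕ → V)) : ℝ≥0∞ :=
  ⨆ σ : M.Strategy, M.runMeasure σ p O

end Measure

/-- The `k`-energy objective: with initial energy `k`, the energy level never drops below `0`. -/
def energy {V : Type*} (M : EnergyParityMDP V) (k : ℕ) : Set (ℕ → V) :=
  {ρ | ∀ l : ℕ, 0 ≤ (k : ℤ) + ∑ i ∈ Finset.range (l + 1), M.cost (ρ i) (ρ (i + 1))}

/-- The parity objective: the least priority that occurs infinitely often is even. -/
def parity {V : Type*} (M : EnergyParityMDP V) : Set (ℕ → V) :=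
  {ρ | ∃ c : ℕ, IsLeast {d : ℕ | ∃ᶠ i in atTop, M.priority (ρ i) = d} c ∧ Even c}

section Extension

variable {V : Type*} [Finite V] [MeasurableSpace V] [DiscreteMeasurableSpace V]

/-- The limit value of a state: the supremum, over all initial energies, of the values of the
energy-parity objectives. -/
noncomputable def limitValue (M : EnergyParityMDP V) (p : V) : ℝ≥0∞ :=
  ⨆ k : ℕ, M.value p (M.energy k ∩ M.parity)

/-- The states of the extension: those of `M`, and a new state `s'` for each controlled state `s`
of limit value `1`. -/
abbrev ExtState (M : EnergyParityMDP V) : Type _ :=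
  V ⊕ {s : V // s ∈ M.controlled ∧ M.limitValue s = 1}

/-- The extension of `M`: each controlled state `s` of limit value `1` gets a new successor `s'` of
priority `0`, with edges `(s, s')` of cost `-1` and `(s', s)` of cost `0`. The new states, each of
which has a single successor, are controlled. -/
noncomputable def extension (M : EnergyParityMDP V) : EnergyParityMDP M.ExtState where
  controlled := {x | Sum.elim (fun s => s ∈ M.controlled) (fun _ => True) x}
  edge
    | .inl s, .inl t => M.edge s t
    | .inl s, .inr t' => s = t'
    | .inr s', .inl t => s' = t
    | .inr _, .inr _ => False
  sinkless
    | .inl s => (M.sinkless s).elim fun t ht => ⟨.inl t, ht⟩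
    | .inr s' => ⟨.inl s', rfl⟩
  prob
    | ⟨.inl s, hs⟩ => (M.prob ⟨s, hs⟩).map Sum.inl
    | ⟨.inr _, hs⟩ => (hs trivial).elim
  prob_edge := by
    rintro ⟨s | s', hs⟩ t ht
    · obtain ⟨u, hu, rfl⟩ := (PMF.mem_support_map_iff _ _ _).1 ((PMF.mem_support_iff _ _).2 ht)
      exact M.prob_edge ⟨s, hs⟩ u ((PMF.mem_support_iff _ _).1 hu)
    · exact (hs trivial).elim
  cost
    | .inl s, .inl t => M.cost s t
    | .inl _, .inr _ => -1
    | .inr _, _ => 0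
  priority := Sum.elim M.priority (fun _ => 0)

/-- Disjoint unions of discrete measurable spaces are discrete. -/
instance discreteMeasurableSpace_sum {α β : Type*} [MeasurableSpace α] [MeasurableSpace β]
    [DiscreteMeasurableSpace α] [DiscreteMeasurableSpace β] :
    DiscreteMeasurableSpace (α ⊕ β) :=
  ⟨fun _ => measurableSet_sum_iff.2 ⟨.of_discrete, .of_discrete⟩⟩

end Extension

end EnergyParityMDP

/-!
Write `val s n` for the value of the energy-parity objective from the state `s` with energy level
`n`, and call the configuration `(s, n)` *sure* if this value is `1`.

**From the extension to the original process.** A strategy of the extension is imitated in `M` by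
skipping the visits to new states. Each skipped visit saves a unit of energy, so after sufficiently
many of them the energy level is nearly optimal for the current state, whose limit value is `1`, and
one can switch to a nearly optimal strategy. Since the strategy of the extension may randomize
between a new state and other moves, this is not done on strategies but on values: `val` does not
increase, on average, along moves of `M`, and it does not notice skipped visits
(`runMeasure_winCount_le`). Runs without new states are dealt with in
`runMeasure_win_inter_noNew_le`.

**From the original process to the extension.** Every sure configuration has a sure successor, and
all moves from sure probabilistic states are sure. A controlled state has *slack* if its
configuration remains sure when one unit of energy is given away. In a controlled state without
slack, the energy level is the least sure one, so there are only finitely many such configurations,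
and a move from them to a configuration that is not sure loses a uniform amount of value
(`exists_gap`). A nearly optimal strategy therefore rarely makes such a move, and, with high
probability, it keeps to sure configurations until it reaches slack, and reaches slack or satisfies
the parity condition. By regularity of the run measure, this also holds for a closed set of runs
(`Sure.exists_strategy_phase`).

In the extension, follow such a strategy, redirected to sure moves, and start afresh as soon as the
play has no continuation in the closed set. A play that is never interrupted and never reaches slack
belongs to the closed set, hence satisfies the parity condition, and each attempt is uninterrupted
with probability at least `1 / 4`. So, as long as no slack is reached, the parity condition fails
with probability `0` (`IsController.failBound_eq_zero`). On reaching slack, spend one unit of energy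
on a visit to the new state, and start afresh. If this happens infinitely often, then the priority
`0` of the new states ensures the parity condition.
-/

namespace EnergyParityMDP

/-! ### Sequences of states and their prefixes -/

/-- The sequence `p, ρ 0, ρ 1, …`. -/
def consRun {V : Type*} (p : V) (ρ : ℕ → V) : ℕ → V
  | 0 => p
  | n + 1 => ρ n

@[simp] lemma consRun_zero {V : Type*} (p : V) (ρ : ℕ → V) : consRun p ρ 0 = p := rfl

@[simp] lemma consRun_succ {V : Type*} (p : V) (ρ : ℕ → V) (n : ℕ) :
    consRun p ρ (n + 1) = ρ n := rfl

/-- The strategy that `σ` prescribes once the state `p` has been prepended to every history. -/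
def Strategy.shift {V : Type*} {M : EnergyParityMDP V} (σ : M.Strategy) (p : V) : M.Strategy where
  choice w s := σ.choice (p :: w) s
  choice_edge w s := σ.choice_edge (p :: w) s

section Next

variable {V : Type*} {M : EnergyParityMDP V}

lemma next_shift (σ : M.Strategy) (p : V) (w : List V) (s : V) :
    M.next (σ.shift p) w s = M.next σ (p :: w) s := rfl

lemma next_controlled (σ : M.Strategy) (w : List V) {s : V} (hs : s ∈ M.controlled) :
    M.next σ w s = σ.choice w ⟨s, hs⟩ := dif_pos hs

lemma next_prob (σ : M.Strategy) (w : List V) {s : V} (hs : s ∉ M.controlled) :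
    M.next σ w s = M.prob ⟨s, hs⟩ := dif_neg hs

lemma next_edge (σ : M.Strategy) (w : List V) {s t : V} (h : M.next σ w s t ≠ 0) :
    M.edge s t := by
  by_cases hs : s ∈ M.controlled
  · rw [next_controlled σ w hs] at h
    exact σ.choice_edge _ _ _ h
  · rw [next_prob σ w hs] at h
    exact M.prob_edge _ _ h

end Next

section Infinite

variable {V : Type*} [MeasurableSpace V] [DiscreteMeasurableSpace V]

lemma measurableEmbedding_consRun [Countable V] (p : V) : MeasurableEmbedding (consRun p) where
  injective ρ ρ' h := funext fun n => congrFun h (n + 1)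
  measurable := by
    refine measurable_pi_lambda _ fun n => ?_
    cases n with
    | zero => exact measurable_const
    | succ n => exact measurable_pi_apply n
  measurableSet_image' := by
    intro A hA
    have : consRun p '' A = {ρ | ρ 0 = p} ∩ (fun ρ n => ρ (n + 1)) ⁻¹' A := by
      ext ρ
      constructor
      · rintro ⟨ρ', h, rfl⟩
        exact ⟨rfl, h⟩
      · rintro ⟨h0, h⟩
        refine ⟨_, h, funext fun n => ?_⟩
        cases n with
        | zero => exact h0.symm
        | succ n => rfl
    rw [this]
    refine MeasurableSet.inter ?_ ?_
    · exact measurableSet_eq_fun (measurable_pi_apply 0) measurable_const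
    · exact hA.preimage (measurable_pi_lambda _ fun n => measurable_pi_apply (n + 1))

/-- Two finite measures on sequences compare as soon as they compare on all sets of sequences with
a prescribed prefix: an open set is an increasing union of finite unions of such sets. -/
lemma measure_le_of_cylinder [Finite V] {μ ν : Measure (ℕ → V)} [IsFiniteMeasure μ]
    [IsFiniteMeasure ν]
    (h : ∀ (n : ℕ) (x : ℕ → V), μ {ρ | ∀ i ≤ n, ρ i = x i} ≤ ν {ρ | ∀ i ≤ n, ρ i = x i}) :
    μ ≤ ν := by
  let _ : TopologicalSpace V := ⊥
  have _ : DiscreteTopology V := ⟨rfl⟩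
  have _ : BorelSpace V := ⟨by
    rw [borel_eq_top_of_discrete]; exact (eq_top_iff.2 fun s _ => MeasurableSet.of_discrete)⟩
  have hopen : ∀ U : Set (ℕ → V), IsOpen U → μ U ≤ ν U := by
    intro U hU
    let Un : ℕ → Set (ℕ → V) := fun n => {x | {ρ | ∀ i ≤ n, ρ i = x i} ⊆ U}
    have hmono : Monotone Un := by
      intro n m hnm x hx ρ hρ
      exact hx fun i hi => hρ i (hi.trans hnm)
    have hUn : U = ⋃ n, Un n := by
      ext x
      simp only [Set.mem_iUnion]
      constructor
      · intro hx
        obtain ⟨I, u, hu, hsub⟩ := isOpen_pi_iff.1 hU x hx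
        refine ⟨I.sup id, fun ρ hρ => hsub fun i hi => ?_⟩
        rw [hρ i (Finset.le_sup (f := id) hi)]
        exact (hu i hi).2
      · rintro ⟨n, hn⟩
        exact hn fun i _ => rfl
    have hle : ∀ n, μ (Un n) ≤ ν (Un n) := by
      intro n
      let r : (ℕ → V) → (Finset.Iic n → V) := fun ρ i => ρ i
      have hr : Measurable r := measurable_pi_lambda _ fun i => measurable_pi_apply _
      have hset : ∀ ρ, r ρ ∈ r '' Un n → ρ ∈ Un n := by
        rintro ρ ⟨x, hx, hxρ⟩ ρ' hρ'
        refine hx fun i hi => ?_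
        rw [hρ' i hi]
        exact (congrFun hxρ ⟨i, Finset.mem_Iic.2 hi⟩).symm
      have hU' : Un n = ⋃ y ∈ r '' Un n, r ⁻¹' {y} := by
        ext ρ
        simp only [Set.mem_iUnion, Set.mem_preimage, Set.mem_singleton_iff, exists_prop]
        constructor
        · intro hρ
          exact ⟨r ρ, ⟨ρ, hρ, rfl⟩, rfl⟩
        · rintro ⟨y, hy, rfl⟩
          exact hset ρ hy
      have hcount : (r '' Un n).Countable := Set.to_countable _
      have hdisj : (r '' Un n).PairwiseDisjoint (fun y => r ⁻¹' {y}) := by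
        intro y _ z _ hyz
        exact Disjoint.preimage r (Set.disjoint_singleton.2 hyz)
      have hms : ∀ y ∈ r '' Un n, MeasurableSet (r ⁻¹' {y}) :=
        fun y _ => hr (measurableSet_singleton y)
      rw [hU', measure_biUnion hcount hdisj hms, measure_biUnion hcount hdisj hms]
      refine ENNReal.tsum_le_tsum ?_
      rintro ⟨y, x, -, rfl⟩
      have : r ⁻¹' {r x} = {ρ | ∀ i ≤ n, ρ i = x i} := by
        ext ρ
        simp only [Set.mem_preimage, Set.mem_singleton_iff, Set.mem_ofPred_eq]
        exact ⟨fun h i hi => congrFun h ⟨i, Finset.mem_Iic.2 hi⟩,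
          fun h => funext fun i => h i (Finset.mem_Iic.1 i.2)⟩
      simpa only [this] using h n x
    rw [hUn, hmono.measure_iUnion, hmono.measure_iUnion]
    exact iSup_mono hle
  refine Measure.le_iff.2 fun A hA => ?_
  refine ENNReal.le_of_forall_pos_le_add fun ε hε _ => ?_
  obtain ⟨U, hAU, hU, hlt⟩ := A.exists_isOpen_lt_add (μ := ν) (measure_ne_top ν A)
    (ENNReal.coe_pos.2 hε).ne'
  exact (measure_mono hAU).trans ((hopen U hU).trans hlt.le)

/-- A set of sequences that contains every sequence all of whose prefixes are prefixes of its
elements, that is, a closed set for the product of the discrete topologies. -/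
def PrefixClosed {V : Type*} (K : Set (ℕ → V)) : Prop :=
  ∀ ρ, (∀ N : ℕ, ∃ ρ' ∈ K, ∀ i ≤ N, ρ' i = ρ i) → ρ ∈ K

lemma exists_prefixClosed_subset [Finite V] {μ : Measure (ℕ → V)} [IsFiniteMeasure μ]
    {A : Set (ℕ → V)} (hA : MeasurableSet A) {ε : ℝ≥0∞} (hε : ε ≠ 0) :
    ∃ K ⊆ A, PrefixClosed K ∧ μ A ≤ μ K + ε := by
  let _ : TopologicalSpace V := ⊥
  have _ : DiscreteTopology V := ⟨rfl⟩
  have _ : BorelSpace V := ⟨by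
    rw [borel_eq_top_of_discrete]; exact (eq_top_iff.2 fun s _ => MeasurableSet.of_discrete)⟩
  obtain ⟨K, hKA, hK, hlt⟩ := hA.exists_isClosed_lt_add (measure_ne_top μ A) hε
  refine ⟨K, hKA, fun ρ hρ => ?_, hlt.le⟩
  by_contra hn
  obtain ⟨I, u, hu, hsub⟩ := isOpen_pi_iff.1 hK.isOpen_compl ρ hn
  obtain ⟨ρ', hρ', heq⟩ := hρ (I.sup id)
  refine hsub (fun i hi => ?_) hρ'
  rw [heq i (Finset.le_sup (f := id) hi)]
  exact (hu i hi).2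

end Infinite

section Runs

variable {V : Type*} [Finite V] [MeasurableSpace V] [DiscreteMeasurableSpace V]
  {M : EnergyParityMDP V}

instance (σ : M.Strategy) (p : V) : IsProbabilityMeasure (M.runMeasure σ p) := by
  unfold runMeasure; infer_instance

open Classical in
lemma runMeasure_zero (σ : M.Strategy) (p : V) (x : ℕ → V) :
    M.runMeasure σ p {ρ | ∀ i ≤ 0, ρ i = x i} = if x 0 = p then 1 else 0 := by
  have h := Kernel.traj_map_frestrictLe_apply (X := fun _ => V) (κ := M.stepKernel σ) 0 0
    (fun _ => p)
  rw [Kernel.partialTraj_self] at h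
  have hset : {ρ : ℕ → V | ∀ i ≤ 0, ρ i = x i} =
      Preorder.frestrictLe (π := fun _ => V) 0 ⁻¹'
        {Preorder.frestrictLe (π := fun _ => V) 0 x} := by
    ext ρ
    simp only [Set.mem_ofPred_eq, Set.mem_preimage, Set.mem_singleton_iff]
    exact ⟨fun h => funext fun i => h i (Finset.mem_Iic.1 i.2),
      fun h i hi => congrFun h ⟨i, Finset.mem_Iic.2 hi⟩⟩
  rw [hset, runMeasure, ← Measure.map_apply (by fun_prop) (measurableSet_singleton _), h,
    Kernel.id_apply, Measure.dirac_apply' _ (measurableSet_singleton _)]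
  split_ifs with hx
  · rw [Set.indicator_of_mem, Pi.one_apply]
    refine funext fun i => ?_
    have : (i : ℕ) = 0 := Nat.le_zero.1 (Finset.mem_Iic.1 i.2)
    change p = x i
    rw [this, hx]
  · rw [Set.indicator_of_notMem]
    intro h
    exact hx (congrFun h ⟨0, Finset.mem_Iic.2 le_rfl⟩).symm

lemma runMeasure_cylinder_succ (σ : M.Strategy) (p : V) (n : ℕ) (x : ℕ → V) :
    M.runMeasure σ p {ρ | ∀ i ≤ n + 1, ρ i = x i} =
      M.runMeasure σ p {ρ | ∀ i ≤ n, ρ i = x i} *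
        M.next σ (List.ofFn fun i : Fin n => x i) (x n) (x (n + 1)) := by
  have h := Kernel.partialTraj_compProd_eq_map_traj (X := fun _ => V) (κ := M.stepKernel σ)
    (zero_le (a := n)) (x₀ := fun _ => p)
  have h1 := Kernel.traj_map_frestrictLe_apply (X := fun _ => V) (κ := M.stepKernel σ) 0 n
    (fun _ => p)
  have hiff : ∀ ρ : ℕ → V, (∀ i ≤ n, ρ i = x i) ↔
      Preorder.frestrictLe (π := fun _ => V) n ρ = Preorder.frestrictLe (π := fun _ => V) n x :=
    fun ρ => ⟨fun h => funext fun i => h i (Finset.mem_Iic.1 i.2),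
      fun h i hi => congrFun h ⟨i, Finset.mem_Iic.2 hi⟩⟩
  have hset : {ρ : ℕ → V | ∀ i ≤ n, ρ i = x i} =
      Preorder.frestrictLe (π := fun _ => V) n ⁻¹'
        {Preorder.frestrictLe (π := fun _ => V) n x} := by
    ext ρ
    exact hiff ρ
  have hset' : {ρ : ℕ → V | ∀ i ≤ n + 1, ρ i = x i} =
      (fun ρ => (Preorder.frestrictLe (π := fun _ => V) n ρ, ρ (n + 1))) ⁻¹'
        ({Preorder.frestrictLe (π := fun _ => V) n x} ×ˢ {x (n + 1)}) := by
    ext ρ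
    simp only [Set.mem_ofPred_eq, Set.mem_preimage, Set.mem_prod, Set.mem_singleton_iff, ← hiff]
    constructor
    · exact fun h => ⟨fun i hi => h i (hi.trans n.le_succ), h _ le_rfl⟩
    · rintro ⟨h, h'⟩ i hi
      rcases Nat.le_succ_iff.1 hi with hi | rfl
      · exact h i hi
      · exact h'
  rw [hset, hset', runMeasure, ← Measure.map_apply (by fun_prop) (measurableSet_singleton _), h1,
    ← Measure.map_apply (by fun_prop) (.prod (measurableSet_singleton _)
      (measurableSet_singleton _)), ← h,
    Measure.compProd_apply_prod (measurableSet_singleton _) (measurableSet_singleton _),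
    Measure.restrict_singleton, lintegral_smul_measure, lintegral_dirac, smul_eq_mul]
  congr 1
  exact PMF.toMeasure_apply_singleton _ _ (measurableSet_singleton _)

end Runs

/-! ### The run measure, one step at a time -/

section OneStep

variable {V : Type*} [Finite V] [MeasurableSpace V] [DiscreteMeasurableSpace V]
  {M : EnergyParityMDP V}

open Classical in
lemma runMeasure_cylinder (σ : M.Strategy) (p : V) (n : ℕ) (x : ℕ → V) :
    M.runMeasure σ p {ρ | ∀ i ≤ n, ρ i = x i} = (if x 0 = p then 1 else 0) *
      ∏ i ∈ Finset.range n, M.next σ (List.ofFn fun j : Fin i => x j) (x i) (x (i + 1)) := by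
  induction n with
  | zero => simpa using runMeasure_zero σ p x
  | succ n ih => rw [runMeasure_cylinder_succ, ih, Finset.prod_range_succ, mul_assoc]

lemma ae_runMeasure_zero (σ : M.Strategy) (p : V) : ∀ᵐ ρ ∂M.runMeasure σ p, ρ 0 = p := by
  have h := runMeasure_zero σ p (fun _ => p)
  simp only [Nat.le_zero_eq, forall_eq, if_true] at h
  rw [ae_iff, ← prob_compl_eq_zero_iff] at *
  · exact h
  · exact measurableSet_eq_fun (measurable_pi_apply 0) measurable_const

/-- The run measure splits according to the first move. -/
lemma runMeasure_eq_sum (σ : M.Strategy) (p : V) :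
    M.runMeasure σ p = Measure.sum fun t =>
      M.next σ [] p t • (M.runMeasure (σ.shift p) t).map (consRun p) := by
  classical
  set ν := Measure.sum fun t =>
      M.next σ [] p t • (M.runMeasure (σ.shift p) t).map (consRun p) with hν
  have happ : ∀ A, ν A = ∑' t, M.next σ [] p t *
      M.runMeasure (σ.shift p) t (consRun p ⁻¹' A) := by
    intro A
    rw [hν, Measure.sum_apply_of_countable]
    refine tsum_congr fun t => ?_
    rw [Measure.smul_apply, (measurableEmbedding_consRun p).map_apply, smul_eq_mul]
  have hfin : IsFiniteMeasure ν := ⟨by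
    rw [happ]
    simp [PMF.tsum_coe]⟩
  have hcyl : ∀ (n : ℕ) (x : ℕ → V), M.runMeasure σ p {ρ | ∀ i ≤ n, ρ i = x i} =
      ν {ρ | ∀ i ≤ n, ρ i = x i} := by
    intro n x
    rw [happ]
    by_cases h0 : x 0 = p
    · cases n with
      | zero =>
        have : consRun p ⁻¹' {ρ | ∀ i ≤ 0, ρ i = x i} = Set.univ := by
          ext ρ
          simp [h0]
        rw [this, runMeasure_cylinder]
        simp [h0, PMF.tsum_coe]
      | succ n =>
        have : consRun p ⁻¹' {ρ | ∀ i ≤ n + 1, ρ i = x i} = {ρ | ∀ i ≤ n, ρ i = x (i + 1)} := by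
          ext ρ
          simp only [Set.mem_preimage, Set.mem_ofPred_eq]
          constructor
          · exact fun h i hi => h (i + 1) (Nat.succ_le_succ hi)
          · intro h i hi
            cases i with
            | zero => exact h0.symm
            | succ i => exact h i (Nat.le_of_succ_le_succ hi)
        rw [this, tsum_eq_single (x 1), runMeasure_cylinder,
          runMeasure_cylinder _ _ _ (fun i => x (i + 1)), if_pos h0, if_pos rfl, one_mul, one_mul,
          Finset.prod_range_succ', mul_comm]
        · congr 1
          · simp [h0]
          · refine Finset.prod_congr rfl fun i _ => ?_
            rw [next_shift, List.ofFn_succ]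
            simp [h0]
        · intro t ht
          rw [runMeasure_cylinder _ _ _ (fun i => x (i + 1)), if_neg (Ne.symm ht), zero_mul,
            mul_zero]
    · have : consRun p ⁻¹' {ρ | ∀ i ≤ n, ρ i = x i} = ∅ := by
        ext ρ
        simp only [Set.mem_preimage, Set.mem_ofPred_eq, Set.mem_empty_iff_false, iff_false]
        exact fun h => h0 (h 0 (zero_le)).symm
      simp [runMeasure_cylinder, this, h0]
  exact le_antisymm (measure_le_of_cylinder fun n x => (hcyl n x).le)
    (measure_le_of_cylinder fun n x => (hcyl n x).ge)

lemma runMeasure_apply (σ : M.Strategy) (p : V) (A : Set (ℕ → V)) :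
    M.runMeasure σ p A = ∑' t, M.next σ [] p t *
      M.runMeasure (σ.shift p) t (consRun p ⁻¹' A) := by
  rw [runMeasure_eq_sum σ p, Measure.sum_apply_of_countable]
  refine tsum_congr fun t => ?_
  rw [Measure.smul_apply, (measurableEmbedding_consRun p).map_apply, smul_eq_mul]

lemma runMeasure_mono (σ : M.Strategy) (p : V) {A B : Set (ℕ → V)}
    (h : ∀ ρ, ρ 0 = p → ρ ∈ A → ρ ∈ B) : M.runMeasure σ p A ≤ M.runMeasure σ p B :=
  measure_mono_ae ((ae_runMeasure_zero σ p).mono fun ρ hρ => h ρ hρ)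

lemma runMeasure_eq_zero (σ : M.Strategy) (p : V) {A : Set (ℕ → V)}
    (h : ∀ ρ, ρ 0 = p → ρ ∉ A) : M.runMeasure σ p A = 0 := by
  rw [← le_zero_iff, ← measure_empty (μ := M.runMeasure σ p)]
  exact runMeasure_mono σ p fun ρ h0 hA => h ρ h0 hA

lemma runMeasure_le_tsum (σ : M.Strategy) (p : V) {A : Set (ℕ → V)} {B : V → Set (ℕ → V)}
    (h : ∀ t, M.next σ [] p t ≠ 0 → ∀ ρ, ρ 0 = t → consRun p ρ ∈ A → ρ ∈ B t) :
    M.runMeasure σ p A ≤ ∑' t, M.next σ [] p t * M.runMeasure (σ.shift p) t (B t) := by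
  rw [runMeasure_apply]
  refine ENNReal.tsum_le_tsum fun t => ?_
  by_cases ht : M.next σ [] p t = 0
  · simp [ht]
  · exact mul_le_mul_right (runMeasure_mono _ _ fun ρ h0 hρ => h t ht ρ h0 hρ) _

lemma tsum_le_runMeasure (σ : M.Strategy) (p : V) {A : Set (ℕ → V)} {B : V → Set (ℕ → V)}
    (h : ∀ t, M.next σ [] p t ≠ 0 → ∀ ρ, ρ 0 = t → ρ ∈ B t → consRun p ρ ∈ A) :
    ∑' t, M.next σ [] p t * M.runMeasure (σ.shift p) t (B t) ≤ M.runMeasure σ p A := by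
  rw [runMeasure_apply]
  refine ENNReal.tsum_le_tsum fun t => ?_
  by_cases ht : M.next σ [] p t = 0
  · simp [ht]
  · exact mul_le_mul_right (runMeasure_mono _ _ fun ρ h0 hρ => h t ht ρ h0 hρ) _

/-- Only the histories that begin with the initial state matter. -/
lemma runMeasure_congr {σ τ : M.Strategy} {p : V}
    (h : ∀ w s, (w ++ [s.1]).head? = some p → σ.choice w s = τ.choice w s) :
    M.runMeasure σ p = M.runMeasure τ p := by
  classical
  have hcyl : ∀ (n : ℕ) (x : ℕ → V), M.runMeasure σ p {ρ | ∀ i ≤ n, ρ i = x i} =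
      M.runMeasure τ p {ρ | ∀ i ≤ n, ρ i = x i} := by
    intro n x
    rw [runMeasure_cylinder, runMeasure_cylinder]
    by_cases h0 : x 0 = p
    · congr 1
      refine Finset.prod_congr rfl fun i _ => ?_
      have : M.next σ (List.ofFn fun j : Fin i => x j) (x i) =
          M.next τ (List.ofFn fun j : Fin i => x j) (x i) := by
        by_cases hs : x i ∈ M.controlled
        · rw [next_controlled _ _ hs, next_controlled _ _ hs, h]
          cases i with
          | zero => simp [h0]
          | succ i => simp [List.ofFn_succ, h0]
        · rw [next_prob _ _ hs, next_prob _ _ hs]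
      rw [this]
    · simp [h0]
  exact le_antisymm (measure_le_of_cylinder fun n x => (hcyl n x).le)
    (measure_le_of_cylinder fun n x => (hcyl n x).ge)

end OneStep

section Construction

variable {V : Type*} [Finite V] [MeasurableSpace V] [DiscreteMeasurableSpace V]
  {M : EnergyParityMDP V}

/-- An arbitrary move from `s`. -/
noncomputable def anyMove (M : EnergyParityMDP V) (s : V) : PMF V := PMF.pure (M.sinkless s).choose

omit [Finite V] [MeasurableSpace V] [DiscreteMeasurableSpace V] in
lemma anyMove_edge {s t : V} (h : M.anyMove s t ≠ 0) : M.edge s t := by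
  classical
  rw [anyMove, PMF.pure_apply] at h
  split_ifs at h with ht
  · exact ht ▸ (M.sinkless s).choose_spec
  · exact absurd rfl h

/-- A first move and strategies for the states that it leads to combine to a strategy. -/
lemma exists_strategy_cons (s : V) (d : PMF V) (f : V → M.Strategy)
    (hd : ∀ t, d t ≠ 0 → M.edge s t) (hp : ∀ h : s ∉ M.controlled, d = M.prob ⟨s, h⟩) :
    ∃ σ : M.Strategy, M.next σ [] s = d ∧
      ∀ t, M.runMeasure (σ.shift s) t = M.runMeasure (f t) t := by
  classical
  refine ⟨⟨fun w s' => match w with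
    | [] => if s'.1 = s then d else M.anyMove s'
    | _ :: w => (f ((w ++ [s'.1]).head (by simp))).choice w s', ?_⟩, ?_, ?_⟩
  · intro w s' t h
    match w with
    | [] =>
      dsimp only at h
      split_ifs at h with hs
      · exact hs ▸ hd t h
      · exact anyMove_edge h
    | _ :: w => exact Strategy.choice_edge _ _ _ _ h
  · by_cases hs : s ∈ M.controlled
    · rw [next_controlled _ _ hs]
      simp
    · rw [next_prob _ _ hs, hp hs]
  · intro t
    refine runMeasure_congr fun w s' h => ?_
    have : (w ++ [s'.1]).head (by simp) = t := by
      rw [List.head?_eq_some_head (by simp)] at h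
      exact Option.some.inj h
    simp only [Strategy.shift, this]

/-- An automaton whose memory states `m` record the current state `cur m` of the play, choose the
next state according to `a m`, and are updated by `u` realizes a strategy from each of its memory
states. -/
lemma exists_strategy_of_automaton {S : Type*} (cur : S → V) (a : S → PMF V) (u : S → V → S)
    (ha : ∀ m t, a m t ≠ 0 → M.edge (cur m) t)
    (hp : ∀ m (h : cur m ∉ M.controlled), a m = M.prob ⟨cur m, h⟩) :
    ∃ τ : S → M.Strategy, ∀ m, M.next (τ m) [] (cur m) = a m ∧
      ∀ t, M.runMeasure ((τ m).shift (cur m)) t = M.runMeasure (τ (u m t)) t := by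
  classical
  refine ⟨fun m => ⟨fun w s => if cur ((w ++ [s.1]).tail.foldl u m) = s then
    a ((w ++ [s.1]).tail.foldl u m) else M.anyMove s, ?_⟩, fun m => ⟨?_, ?_⟩⟩
  · intro w s t h
    split_ifs at h with hs
    · exact hs ▸ ha _ _ h
    · exact anyMove_edge h
  · by_cases hs : cur m ∈ M.controlled
    · rw [next_controlled _ _ hs]
      simp
    · rw [next_prob _ _ hs, hp m hs]
  · intro t
    refine runMeasure_congr fun w s h => ?_
    obtain ⟨l, hl⟩ : ∃ l, w ++ [s.1] = t :: l := by
      cases hw : w ++ [s.1] with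
      | nil => simp at hw
      | cons b l =>
        rw [hw] at h
        exact ⟨l, by rw [Option.some.inj h]⟩
    simp only [Strategy.shift, List.cons_append, List.tail_cons, hl, List.foldl_cons]

end Construction

/-! ### The value of the energy-parity objective -/

section Objective

variable {V : Type*} (M : EnergyParityMDP V)

/-- The energy level at time `i` of the run `ρ` with initial energy `n`. -/
def level (n : ℤ) (ρ : ℕ → V) (i : ℕ) : ℤ :=
  n + ∑ j ∈ Finset.range i, M.cost (ρ j) (ρ (j + 1))

/-- The energy-parity objective for an initial energy `n`, which may be negative: the condition
`0 ≤ n` is part of the objective. -/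
def win (n : ℤ) : Set (ℕ → V) :=
  {ρ | ∀ i, 0 ≤ M.level n ρ i} ∩ M.parity

variable {M}

@[simp] lemma level_zero (n : ℤ) (ρ : ℕ → V) : M.level n ρ 0 = n := by simp [level]

lemma level_consRun (n : ℤ) (s : V) (ρ : ℕ → V) (i : ℕ) :
    M.level n (consRun s ρ) (i + 1) = M.level (n + M.cost s (ρ 0)) ρ i := by
  simp [level, Finset.sum_range_succ', add_assoc, add_comm]

lemma energy_inter_parity (k : ℕ) : M.energy k ∩ M.parity = M.win k := by
  ext ρ
  refine and_congr_left fun _ => ⟨fun h i => ?_, fun h l => h (l + 1)⟩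
  cases i with
  | zero => simp
  | succ i => exact h i

lemma consRun_mem_parity (s : V) (ρ : ℕ → V) : consRun s ρ ∈ M.parity ↔ ρ ∈ M.parity := by
  have : ∀ d, (∃ᶠ i in atTop, M.priority (consRun s ρ i) = d) ↔
      ∃ᶠ i in atTop, M.priority (ρ i) = d := by
    intro d
    conv_lhs => rw [← Filter.map_add_atTop_eq_nat 1, Filter.frequently_map]
    rfl
  simp only [parity, Set.mem_ofPred_eq, this]

lemma nonneg_of_mem_win {n : ℤ} {ρ : ℕ → V} (h : ρ ∈ M.win n) : 0 ≤ n := by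
  simpa using h.1 0

lemma consRun_mem_win {n : ℤ} (s : V) (ρ : ℕ → V) :
    consRun s ρ ∈ M.win n ↔ 0 ≤ n ∧ ρ ∈ M.win (n + M.cost s (ρ 0)) := by
  constructor
  · intro h
    exact ⟨nonneg_of_mem_win h, fun i => (level_consRun n s ρ i) ▸ h.1 (i + 1),
      (consRun_mem_parity s ρ).1 h.2⟩
  · rintro ⟨h0, h⟩
    refine ⟨fun i => ?_, (consRun_mem_parity s ρ).2 h.2⟩
    cases i with
    | zero => simpa using h0
    | succ i => exact (level_consRun n s ρ i).symm ▸ h.1 i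

lemma win_mono {n m : ℤ} (h : n ≤ m) : M.win n ⊆ M.win m := by
  rintro ρ ⟨h1, h2⟩
  refine ⟨fun i => (h1 i).trans ?_, h2⟩
  unfold level
  gcongr

lemma measurableSet_parity [Countable V] [MeasurableSpace V] [DiscreteMeasurableSpace V] :
    MeasurableSet M.parity := by
  have h : ∀ d, MeasurableSet {ρ : ℕ → V | ∃ᶠ i in atTop, M.priority (ρ i) = d} := by
    intro d
    simp only [Filter.frequently_atTop]
    refine MeasurableSet.congr (s := ⋂ a, ⋃ b ≥ a, {ρ : ℕ → V | M.priority (ρ b) = d}) ?_ ?_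
    · refine .iInter fun a => .iUnion fun b => .iUnion fun _ => ?_
      exact (MeasurableSet.of_discrete (s := {v | M.priority v = d})).preimage
        (measurable_pi_apply b)
    · ext ρ
      simp
  have : M.parity = ⋃ c ∈ {c : ℕ | Even c}, {ρ : ℕ → V | ∃ᶠ i in atTop, M.priority (ρ i) = c} ∩
      ⋂ d ∈ Set.Iio c, {ρ : ℕ → V | ∃ᶠ i in atTop, M.priority (ρ i) = d}ᶜ := by
    ext ρ
    simp only [parity, Set.mem_ofPred_eq, Set.mem_iUnion, Set.mem_inter_iff, Set.mem_iInter,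
      Set.mem_compl_iff, Set.mem_Iio, exists_prop]
    refine exists_congr fun c => ?_
    rw [and_comm]
    refine and_congr_right fun _ => and_congr_right fun _ => ?_
    constructor
    · intro h d hd hf
      exact absurd (h hf) (not_le.2 hd)
    · intro h d hf
      exact not_lt.1 fun hd => h d hd hf
  rw [this]
  refine .biUnion (Set.to_countable _) fun c _ => (h c).inter ?_
  exact .biInter (Set.to_countable _) fun d _ => (h d).compl

lemma measurable_level [Countable V] [MeasurableSpace V] [DiscreteMeasurableSpace V] (n : ℤ)
    (i : ℕ) : Measurable fun ρ => M.level n ρ i := by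
  unfold level
  refine measurable_const.add (Finset.measurable_fun_sum _ fun j _ => ?_)
  exact (Measurable.of_discrete (f := fun x : V × V => M.cost x.1 x.2)).comp
    (((measurable_pi_apply j : Measurable fun ρ : ℕ → V => ρ j)).prodMk
      (measurable_pi_apply (j + 1)))

lemma measurableSet_win [Countable V] [MeasurableSpace V] [DiscreteMeasurableSpace V] (n : ℤ) :
    MeasurableSet (M.win n) := by
  refine MeasurableSet.inter ?_ measurableSet_parity
  refine MeasurableSet.congr (s := ⋂ i, (fun ρ => M.level n ρ i) ⁻¹' Set.Ici 0) ?_ ?_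
  · exact .iInter fun i => (measurable_level n i) measurableSet_Ici
  · ext ρ
    simp

end Objective

section Value

variable {V : Type*} [Finite V] [MeasurableSpace V] [DiscreteMeasurableSpace V]
  (M : EnergyParityMDP V)

/-- The value of the energy-parity objective from the state `s` with energy level `n`. -/
noncomputable def val (s : V) (n : ℤ) : ℝ≥0∞ := M.value s (M.win n)

variable {M}

lemma runMeasure_win_le_val (σ : M.Strategy) (s : V) (n : ℤ) :
    M.runMeasure σ s (M.win n) ≤ M.val s n :=
  le_iSup (fun σ : M.Strategy => M.runMeasure σ s (M.win n)) σ

lemma val_le_one (s : V) (n : ℤ) : M.val s n ≤ 1 := iSup_le fun _ => prob_le_one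

lemma val_mono (s : V) {n m : ℤ} (h : n ≤ m) : M.val s n ≤ M.val s m :=
  iSup_mono fun _ => measure_mono (win_mono h)

lemma exists_val_le_runMeasure_add (s : V) (n : ℤ) {ε : ℝ≥0∞} (hε : ε ≠ 0) :
    ∃ σ : M.Strategy, M.val s n ≤ M.runMeasure σ s (M.win n) + ε := by
  by_cases h0 : M.val s n = 0
  · exact ⟨⟨fun _ s => M.anyMove s, fun _ _ _ h => anyMove_edge h⟩, by simp [h0]⟩
  · have : M.val s n - ε < M.val s n :=
      ENNReal.sub_lt_self ((val_le_one s n).trans_lt ENNReal.one_lt_top).ne h0 hε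
    obtain ⟨σ, hσ⟩ := lt_iSup_iff.1 this
    exact ⟨σ, tsub_le_iff_right.1 hσ.le⟩

lemma val_of_neg (s : V) {n : ℤ} (hn : n < 0) : M.val s n = 0 := by
  refine le_antisymm (iSup_le fun σ => ?_) zero_le
  refine (runMeasure_eq_zero σ s fun ρ _ hρ => ?_).le
  exact absurd (nonneg_of_mem_win hρ) (not_le.2 hn)

lemma runMeasure_win_eq_tsum (σ : M.Strategy) (s : V) {n : ℤ} (hn : 0 ≤ n) :
    M.runMeasure σ s (M.win n) = ∑' t, M.next σ [] s t *
      M.runMeasure (σ.shift s) t (M.win (n + M.cost s t)) := by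
  refine le_antisymm (runMeasure_le_tsum σ s ?_) (tsum_le_runMeasure σ s ?_)
  · rintro t - ρ rfl h
    exact ((consRun_mem_win s ρ).1 h).2
  · rintro t - ρ rfl h
    exact (consRun_mem_win s ρ).2 ⟨hn, h⟩

/-- A distribution over the moves from `s` cannot do better, on average, than the value of `s`. -/
lemma tsum_mul_val_le (s : V) {n : ℤ} (hn : 0 ≤ n) (d : PMF V)
    (hd : ∀ t, d t ≠ 0 → M.edge s t) (hp : ∀ h : s ∉ M.controlled, d = M.prob ⟨s, h⟩) :
    ∑' t, d t * M.val t (n + M.cost s t) ≤ M.val s n := by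
  refine ENNReal.le_of_forall_pos_le_add fun ε hε _ => ?_
  choose f hf using fun t => exists_val_le_runMeasure_add (M := M) t (n + M.cost s t)
    (ENNReal.coe_pos.2 hε).ne'
  obtain ⟨σ, hσ, hσf⟩ := exists_strategy_cons s d f hd hp
  calc ∑' t, d t * M.val t (n + M.cost s t)
      ≤ ∑' t, d t * (M.runMeasure (f t) t (M.win (n + M.cost s t)) + ε) :=
        ENNReal.tsum_le_tsum fun t => mul_le_mul_right (hf t) _
    _ = M.runMeasure σ s (M.win n) + ε := by
        simp_rw [mul_add]
        rw [ENNReal.tsum_add, ENNReal.tsum_mul_right, PMF.tsum_coe, one_mul,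
          runMeasure_win_eq_tsum σ s hn, hσ]
        simp_rw [hσf]
    _ ≤ M.val s n + ε := by
        gcongr
        exact runMeasure_win_le_val σ s n

lemma val_le_of_edge {s t : V} (hs : s ∈ M.controlled) (he : M.edge s t) {n : ℤ} (hn : 0 ≤ n) :
    M.val t (n + M.cost s t) ≤ M.val s n := by
  classical
  refine le_trans ?_ (tsum_mul_val_le s hn (PMF.pure t) ?_ fun h => absurd hs h)
  · rw [tsum_eq_single t]
    · simp
    · intro b hb
      simp [PMF.pure_apply, hb]
  · intro b hb
    rw [PMF.pure_apply] at hb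
    split_ifs at hb with h
    · exact h ▸ he
    · exact absurd rfl hb

lemma runMeasure_win_le_tsum_val (σ : M.Strategy) (s : V) (n : ℤ) :
    M.runMeasure σ s (M.win n) ≤ ∑' t, M.next σ [] s t * M.val t (n + M.cost s t) := by
  by_cases hn : 0 ≤ n
  · rw [runMeasure_win_eq_tsum σ s hn]
    exact ENNReal.tsum_le_tsum fun t => mul_le_mul_right (runMeasure_win_le_val _ _ _) _
  · refine le_of_eq_of_le ?_ zero_le
    exact runMeasure_eq_zero σ s fun ρ _ hρ => hn (nonneg_of_mem_win hρ)

variable (M) in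
/-- The energy level `n` at `s` makes the value of the energy-parity objective equal to `1`. -/
def Sure (s : V) (n : ℤ) : Prop := M.val s n = 1

lemma Sure.nonneg {s : V} {n : ℤ} (h : M.Sure s n) : 0 ≤ n := by
  by_contra hn
  rw [Sure, val_of_neg s (not_le.1 hn)] at h
  exact zero_ne_one h

lemma Sure.mono {s : V} {n m : ℤ} (h : M.Sure s n) (hnm : n ≤ m) : M.Sure s m :=
  le_antisymm (val_le_one s m) (h.symm.le.trans (val_mono s hnm))

lemma Sure.limitValue {s : V} {n : ℤ} (h : M.Sure s n) : M.limitValue s = 1 := by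
  refine le_antisymm (iSup_le fun _ => iSup_le fun _ => prob_le_one) ?_
  have := le_iSup (fun k : ℕ => M.value s (M.energy k ∩ M.parity)) n.toNat
  rw [energy_inter_parity, Int.toNat_of_nonneg h.nonneg] at this
  exact h.symm.le.trans this

lemma eq_one_of_one_le_tsum {α : Type*} (d : PMF α) {f : α → ℝ≥0∞} (hf : ∀ x, f x ≤ 1)
    (h : 1 ≤ ∑' x, d x * f x) {x : α} (hx : d x ≠ 0) : f x = 1 := by
  by_contra hne
  have hlt : f x < 1 := lt_of_le_of_ne (hf x) hne
  have : ∑' x, d x * f x < ∑' x, d x * 1 := by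
    refine ENNReal.tsum_lt_tsum (i := x) ?_ (fun y => mul_le_mul_right (hf y) _) ?_
    · refine (lt_of_le_of_lt (ENNReal.tsum_le_tsum fun y => mul_le_of_le_one_right' (hf y)) ?_).ne
      rw [PMF.tsum_coe]
      exact ENNReal.one_lt_top
    · exact (ENNReal.mul_lt_mul_iff_right hx (PMF.apply_ne_top d x)).2 hlt
  simp only [mul_one, PMF.tsum_coe] at this
  exact absurd h (not_le.2 this)

lemma Sure.of_prob {s t : V} {n : ℤ} (h : M.Sure s n) (hs : s ∉ M.controlled)
    (ht : M.prob ⟨s, hs⟩ t ≠ 0) : M.Sure t (n + M.cost s t) := by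
  refine eq_one_of_one_le_tsum (M.prob ⟨s, hs⟩) (f := fun t => M.val t (n + M.cost s t))
    (fun t => val_le_one _ _) ?_ ht
  refine h.symm.le.trans (iSup_le fun σ => ?_)
  have := runMeasure_win_le_tsum_val σ s n
  rwa [next_prob σ [] hs] at this

/-- Among finitely many moves, one attains the value `1`. -/
lemma Sure.exists_edge {s : V} {n : ℤ} (h : M.Sure s n) :
    ∃ t, M.edge s t ∧ M.Sure t (n + M.cost s t) := by
  by_contra! hne
  have hlt : ∀ t : {t // M.edge s t}, M.val t (n + M.cost s t) < 1 :=
    fun t => lt_of_le_of_ne (val_le_one _ _) (hne t t.2)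
  obtain ⟨t₀, h₀⟩ := M.sinkless s
  have : Nonempty {t // M.edge s t} := ⟨⟨t₀, h₀⟩⟩
  obtain ⟨t₁, h₁⟩ := Finite.exists_max fun t : {t // M.edge s t} => M.val t (n + M.cost s t)
  have : M.val s n ≤ M.val t₁ (n + M.cost s t₁) := by
    refine iSup_le fun σ => (runMeasure_win_le_tsum_val σ s n).trans ?_
    calc ∑' t, M.next σ [] s t * M.val t (n + M.cost s t)
        ≤ ∑' t, M.next σ [] s t * M.val t₁ (n + M.cost s t₁) := by
          refine ENNReal.tsum_le_tsum fun t => ?_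
          by_cases ht : M.next σ [] s t = 0
          · simp [ht]
          · exact mul_le_mul_right (h₁ ⟨t, next_edge σ [] ht⟩) _
      _ = M.val t₁ (n + M.cost s t₁) := by
          rw [ENNReal.tsum_mul_right, PMF.tsum_coe, one_mul]
  exact absurd (h.symm.le.trans this) (not_le.2 (hlt t₁))

end Value

/-! ### From the extension to the original process -/

lemma tsum_map_mul {α β : Type*} (p : PMF α) (f : α → β) (g : β → ℝ≥0∞) :
    ∑' b, p.map f b * g b = ∑' a, p a * g (f a) := by
  classical
  simp_rw [PMF.map_apply, ← ENNReal.tsum_mul_right]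
  rw [ENNReal.tsum_comm]
  refine tsum_congr fun a => ?_
  rw [tsum_eq_single (f a)]
  · simp
  · intro b hb
    simp [hb]

section Extension

variable {V : Type*} [Finite V] [MeasurableSpace V] [DiscreteMeasurableSpace V]
  {M : EnergyParityMDP V}

/-- The state of `M` underlying a state of the extension. -/
def base (x : M.ExtState) : V := Sum.elim id (fun s => s.1) x

variable (M) in
/-- The runs of the extension that never visit a new state. -/
def noNew : Set (ℕ → M.ExtState) := {ρ | ∀ i, (ρ i).isLeft}

lemma eq_inl_base {x : M.ExtState} (h : x.isLeft) : x = Sum.inl (base x) := by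
  cases x with
  | inl s => rfl
  | inr s => simp at h

lemma level_base {ρ : ℕ → M.ExtState} (h : ρ ∈ M.noNew) (n : ℤ) (i : ℕ) :
    M.level n (fun i => base (ρ i)) i = M.extension.level n ρ i := by
  unfold level
  congr 1
  refine Finset.sum_congr rfl fun j _ => ?_
  rw [eq_inl_base (h j), eq_inl_base (h (j + 1))]
  rfl

lemma parity_base {ρ : ℕ → M.ExtState} (h : ρ ∈ M.noNew) :
    (fun i => base (ρ i)) ∈ M.parity ↔ ρ ∈ M.extension.parity := by
  have : ∀ i, M.priority (base (ρ i)) = M.extension.priority (ρ i) := by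
    intro i
    rw [eq_inl_base (h i)]
    rfl
  simp only [parity, Set.mem_ofPred_eq, this]

lemma next_extension_inl_prob (σ : M.extension.Strategy) (w : List M.ExtState) {s : V}
    (hs : s ∉ M.controlled) :
    M.extension.next σ w (Sum.inl s) = (M.prob ⟨s, hs⟩).map Sum.inl :=
  next_prob σ w (s := Sum.inl s) hs

/-- A strategy of the extension wins without visiting a new state with a probability that is at
most the value in the original process, in which one can imitate it: moves to a new state are
replaced by arbitrary ones, and this only adds to the probabilities of the other moves. -/
lemma runMeasure_win_inter_noNew_le (σ : M.extension.Strategy) (s : V) (n : ℤ) :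
    M.extension.runMeasure σ (Sum.inl s) (M.extension.win n ∩ M.noNew) ≤ M.val s n := by
  classical
  let f : V → M.ExtState → V := fun s => Sum.elim id fun _ => (M.sinkless s).choose
  let τ : M.Strategy := ⟨fun w s => (σ.choice (w.map Sum.inl) ⟨Sum.inl s.1, s.2⟩).map (f s), by
    intro w s t ht
    obtain ⟨x, hx, rfl⟩ := (PMF.mem_support_map_iff _ _ _).1 ((PMF.mem_support_iff _ _).2 ht)
    have := σ.choice_edge _ _ _ ((PMF.mem_support_iff _ _).1 hx)
    cases x with
    | inl t => exact this
    | inr t => exact (M.sinkless s).choose_spec⟩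
  have hnext : ∀ w s t, M.extension.next σ (w.map Sum.inl) (Sum.inl s) (Sum.inl t) ≤
      M.next τ w s t := by
    intro w s t
    by_cases hs : s ∈ M.controlled
    · rw [next_controlled τ w hs, next_controlled σ _ (s := Sum.inl s) hs]
      simp only [τ, PMF.map_apply]
      refine le_trans ?_ (ENNReal.le_tsum (Sum.inl t))
      simp [f]
    · rw [next_prob τ w hs, next_extension_inl_prob σ _ hs, PMF.map_apply]
      rw [tsum_eq_single t]
      · simp
      · intro b hb
        simp [hb.symm]
  let R : (ℕ → M.ExtState) → ℕ → V := fun ρ i => base (ρ i)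
  have hR : Measurable R := measurable_pi_lambda _ fun i =>
    (Measurable.of_discrete (f := base)).comp (measurable_pi_apply i)
  have hle : ((M.extension.runMeasure σ (Sum.inl s)).restrict M.noNew).map R ≤
      M.runMeasure τ s := by
    refine measure_le_of_cylinder fun n x => ?_
    have hmeas : MeasurableSet {ρ : ℕ → V | ∀ i ≤ n, ρ i = x i} := by
      refine MeasurableSet.congr (s := ⋂ i ≤ n, (fun ρ : ℕ → V => ρ i) ⁻¹' {x i}) ?_ ?_
      · exact .iInter fun i => .iInter fun _ => (measurable_pi_apply i) .of_discrete
      · ext ρ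
        simp
    rw [Measure.map_apply hR hmeas, Measure.restrict_apply (hR hmeas)]
    calc M.extension.runMeasure σ (Sum.inl s) (R ⁻¹' {ρ | ∀ i ≤ n, ρ i = x i} ∩ M.noNew)
        ≤ M.extension.runMeasure σ (Sum.inl s) {ρ | ∀ i ≤ n, ρ i = Sum.inl (x i)} := by
          refine measure_mono ?_
          rintro ρ ⟨h1, h2⟩ i hi
          rw [eq_inl_base (h2 i)]
          exact congrArg Sum.inl (h1 i hi)
      _ ≤ M.runMeasure τ s {ρ | ∀ i ≤ n, ρ i = x i} := by
          rw [runMeasure_cylinder σ _ n (fun i => Sum.inl (x i)), runMeasure_cylinder]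
          simp only [Sum.inl.injEq]
          gcongr with i hi
          have := hnext (List.ofFn fun j : Fin i => x j) (x i) (x (i + 1))
          rwa [List.map_ofFn] at this
  calc M.extension.runMeasure σ (Sum.inl s) (M.extension.win n ∩ M.noNew)
      ≤ ((M.extension.runMeasure σ (Sum.inl s)).restrict M.noNew).map R (M.win n) := by
        rw [Measure.map_apply hR (measurableSet_win n),
          Measure.restrict_apply (hR (measurableSet_win n))]
        refine measure_mono ?_
        rintro ρ ⟨h1, h2⟩
        refine ⟨⟨fun i => ?_, (parity_base h2).2 h1.2⟩, h2⟩
        exact (level_base h2 n i).symm ▸ h1.1 i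
    _ ≤ M.runMeasure τ s (M.win n) := hle _
    _ ≤ M.val s n := runMeasure_win_le_val τ s n

/-- The number of visits to new states before time `N`. -/
def countNew (N : ℕ) (ρ : ℕ → M.ExtState) : ℕ :=
  ∑ i ∈ Finset.range N, if (ρ i).isRight then 1 else 0

lemma countNew_consRun (N : ℕ) (x : M.ExtState) (ρ : ℕ → M.ExtState) :
    countNew (N + 1) (consRun x ρ) = countNew N ρ + if x.isRight then 1 else 0 := by
  simp only [countNew, Finset.sum_range_succ', consRun_succ, consRun_zero]
  rfl

variable (M) in
/-- The winning runs, for the initial energy `n`, with at least `j` visits to new states before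
time `N` or with no such visit from time `N` on. -/
def winCount (N j : ℕ) (n : ℤ) : Set (ℕ → M.ExtState) :=
  M.extension.win n ∩ ({ρ | j ≤ countNew N ρ} ∪ {ρ | ∀ i ≥ N, (ρ i).isLeft})

lemma of_consRun_mem_winCount {N j : ℕ} {n : ℤ} {x : M.ExtState} {ρ : ℕ → M.ExtState}
    (h : consRun x ρ ∈ M.winCount (N + 1) (j + if x.isRight then 1 else 0) n) :
    ρ ∈ M.winCount N j (n + M.extension.cost x (ρ 0)) := by
  refine ⟨((consRun_mem_win x ρ).1 h.1).2, h.2.imp (fun h => ?_) fun h i hi => ?_⟩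
  · simpa [countNew_consRun] using h
  · exact h (i + 1) (Nat.succ_le_succ hi)

/-- Visits to new states are skipped in `M`, which saves a unit of energy each time. Once enough of
them have been skipped, the energy level is at least `K`, and `K` is nearly optimal for each state
of limit value `1`. The number `j` of visits that are still to be skipped, the energy level `n` in
the extension and the energy level `m` in `M` are tied by `n + (K - j) ≤ m`. The induction is on the
time `N` after which no further visit is taken into account. -/
lemma runMeasure_winCount_le {K : ℕ} {ε : ℝ≥0∞}
    (hK : ∀ s, M.limitValue s = 1 → 1 ≤ M.val s K + ε) (N : ℕ) :
    (∀ (σ : M.extension.Strategy) s j (n m : ℤ), 1 ≤ j → j ≤ K → n + (K - j) ≤ m →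
      M.extension.runMeasure σ (Sum.inl s) (M.winCount N j n) ≤ M.val s m + ε) ∧
    (∀ (σ : M.extension.Strategy) s j (n m : ℤ), 1 ≤ j → j ≤ K → n + (K - j) + 1 ≤ m →
      M.extension.runMeasure σ (Sum.inr s) (M.winCount N j n) ≤ M.val s.1 m + ε) := by
  have hempty : ∀ (σ : M.extension.Strategy) x N j (n : ℤ), n < 0 →
      M.extension.runMeasure σ x (M.winCount N j n) = 0 := fun σ x N j n hn =>
    runMeasure_eq_zero σ x fun ρ _ hρ => absurd (nonneg_of_mem_win hρ.1) (not_le.2 hn)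
  induction N with
  | zero =>
    refine ⟨fun σ s j n m h1 hj hm => ?_, fun σ s j n m h1 hj hm => ?_⟩
    · refine le_trans ?_ (((runMeasure_win_inter_noNew_le σ s n).trans
        (val_mono s (by omega))).trans le_self_add)
      refine measure_mono fun ρ hρ => ⟨hρ.1, fun i => ?_⟩
      rcases hρ.2 with h | h
      · simp only [Set.mem_ofPred_eq, countNew, Finset.range_zero, Finset.sum_empty] at h
        omega
      · exact h i (zero_le)
    · refine le_of_eq_of_le (runMeasure_eq_zero σ _ ?_) zero_le
      rintro ρ h0 ⟨-, h | h⟩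
      · simp only [Set.mem_ofPred_eq, countNew, Finset.range_zero, Finset.sum_empty] at h
        omega
      · have := h 0 le_rfl
        simp [h0] at this
  | succ N ih =>
    refine ⟨fun σ s j n m h1 hj hm => ?_, fun σ s j n m h1 hj hm => ?_⟩
    · rcases lt_or_ge n 0 with hn | hn
      · simp [hempty σ _ _ _ _ hn]
      refine (runMeasure_le_tsum σ (Sum.inl s)
        (B := fun x => M.winCount N j (n + M.extension.cost (Sum.inl s) x)) ?_).trans ?_
      · rintro x - ρ rfl h
        exact of_consRun_mem_winCount (by simpa using h)
      by_cases hs : s ∈ M.controlled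
      · calc _ ≤ ∑' x, M.extension.next σ [] (Sum.inl s) x * (M.val s m + ε) := by
              refine ENNReal.tsum_le_tsum fun x => ?_
              by_cases hx : M.extension.next σ [] (Sum.inl s) x = 0
              · simp [hx]
              refine mul_le_mul_right ?_ _
              have he := next_edge σ [] hx
              cases x with
              | inl t =>
                have hcost : M.extension.cost (Sum.inl s) (Sum.inl t) = M.cost s t := rfl
                rw [hcost]
                refine (ih.1 _ t j _ (m + M.cost s t) h1 hj (by omega)).trans ?_
                gcongr
                exact val_le_of_edge hs he (by omega)
              | inr t =>
                have hst : s = t.1 := he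
                have hcost : M.extension.cost (Sum.inl s) (Sum.inr t) = -1 := rfl
                rw [hcost, hst]
                exact ih.2 _ t j _ m h1 hj (by omega)
          _ = M.val s m + ε := by rw [ENNReal.tsum_mul_right, PMF.tsum_coe, one_mul]
      · rw [next_extension_inl_prob σ [] hs, tsum_map_mul]
        calc _ ≤ ∑' t, M.prob ⟨s, hs⟩ t * (M.val t (m + M.cost s t) + ε) := by
              refine ENNReal.tsum_le_tsum fun t => mul_le_mul_right ?_ _
              have hcost : M.extension.cost (Sum.inl s) (Sum.inl t) = M.cost s t := rfl
              rw [hcost]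
              exact ih.1 _ t j _ (m + M.cost s t) h1 hj (by omega)
          _ = (∑' t, M.prob ⟨s, hs⟩ t * M.val t (m + M.cost s t)) + ε := by
              simp_rw [mul_add]
              rw [ENNReal.tsum_add, ENNReal.tsum_mul_right, PMF.tsum_coe, one_mul]
          _ ≤ M.val s m + ε := by
              gcongr
              exact tsum_mul_val_le s (by omega) _ (fun t => M.prob_edge ⟨s, hs⟩ t) fun _ => rfl
    · rcases lt_or_ge n 0 with hn | hn
      · simp [hempty σ _ _ _ _ hn]
      obtain ⟨j, rfl⟩ := Nat.exists_eq_add_of_le' h1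
      rcases Nat.eq_zero_or_pos j with rfl | hj0
      -- The last visit to be skipped: here `m` is at least `K`, so `hK` applies.
      · exact prob_le_one.trans ((hK s s.2.2).trans (by
          gcongr
          exact val_mono s.1 (by push_cast at hm; omega)))
      refine (runMeasure_le_tsum σ (Sum.inr s)
        (B := fun x => M.winCount N j (n + M.extension.cost (Sum.inr s) x)) ?_).trans ?_
      · rintro x - ρ rfl h
        exact of_consRun_mem_winCount (by simpa using h)
      calc _ ≤ ∑' x, M.extension.next σ [] (Sum.inr s) x * (M.val s.1 m + ε) := by
            refine ENNReal.tsum_le_tsum fun x => ?_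
            by_cases hx : M.extension.next σ [] (Sum.inr s) x = 0
            · simp [hx]
            refine mul_le_mul_right ?_ _
            have he := next_edge σ [] hx
            cases x with
            | inl t =>
              have hst : s.1 = t := he
              have hcost : M.extension.cost (Sum.inr s) (Sum.inl t) = 0 := rfl
              rw [hcost, ← hst]
              exact ih.1 _ s.1 j _ m hj0 (by omega) (by push_cast at hm; omega)
            | inr t => exact he.elim
        _ = M.val s.1 m + ε := by rw [ENNReal.tsum_mul_right, PMF.tsum_coe, one_mul]

lemma countNew_mono (ρ : ℕ → M.ExtState) : Monotone fun N => countNew N ρ := by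
  intro N N' h
  exact Finset.sum_le_sum_of_subset (Finset.range_mono h)

lemma exists_mem_winCount {n : ℤ} {ρ : ℕ → M.ExtState} (h : ρ ∈ M.extension.win n) (j : ℕ) :
    ∃ N, ρ ∈ M.winCount N j n := by
  by_cases hfin : ∃ N, ∀ i ≥ N, (ρ i).isLeft
  · exact hfin.imp fun N hN => ⟨h, .inr hN⟩
  push Not at hfin
  suffices ∃ N, j ≤ countNew N ρ from this.imp fun N hN => ⟨h, .inl hN⟩
  induction j with
  | zero => exact ⟨0, zero_le⟩
  | succ j ih =>
    obtain ⟨N, hN⟩ := ih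
    obtain ⟨i, hi, hr⟩ := hfin N
    refine ⟨i + 1, ?_⟩
    have h1 : countNew (i + 1) ρ = countNew i ρ + 1 := by
      have hr' : (ρ i).isRight = true := by simpa using hr
      rw [countNew, Finset.sum_range_succ, if_pos hr']
      rfl
    rw [h1]
    exact Nat.succ_le_succ (hN.trans (countNew_mono ρ hi))

lemma winCount_mono (j : ℕ) (n : ℤ) : Monotone fun N => M.winCount N j n := by
  intro N N' h ρ hρ
  refine ⟨hρ.1, hρ.2.imp (fun h' => ?_) fun h' i hi => h' i (h.trans hi)⟩
  exact le_trans h' (countNew_mono ρ h)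

/-- An energy level that is nearly optimal for all states of limit value `1` at once. -/
lemma exists_level_of_limitValue {ε : ℝ≥0∞} (hε : ε ≠ 0) :
    ∃ K : ℕ, 1 ≤ K ∧ ∀ s, M.limitValue s = 1 → 1 ≤ M.val s K + ε := by
  have : ∀ s, ∃ k : ℕ, M.limitValue s = 1 → 1 ≤ M.val s k + ε := by
    intro s
    by_cases hs : M.limitValue s = 1
    · have hlt : 1 - ε < ⨆ k : ℕ, M.value s (M.energy k ∩ M.parity) :=
        (ENNReal.sub_lt_self ENNReal.one_ne_top one_ne_zero hε).trans_eq hs.symm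
      obtain ⟨k, hk⟩ := lt_iSup_iff.1 hlt
      rw [energy_inter_parity] at hk
      exact ⟨k, fun _ => tsub_le_iff_right.1 hk.le⟩
    · exact ⟨0, fun h => absurd h hs⟩
  choose k hk using this
  obtain ⟨K, hK⟩ := Finite.exists_le k
  refine ⟨K + 1, by omega, fun s hs => (hk s hs).trans ?_⟩
  gcongr
  exact val_mono s (by exact_mod_cast (hK s).trans K.le_succ)

lemma sure_of_runMeasure_extension {σ : M.extension.Strategy} {p : V} {n : ℤ}
    (h : M.extension.runMeasure σ (Sum.inl p) (M.extension.win n) = 1) : M.Sure p n := by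
  refine le_antisymm (val_le_one p n) (ENNReal.le_of_forall_pos_le_add fun ε hε _ => ?_)
  obtain ⟨K, hK1, hK⟩ := exists_level_of_limitValue (M := M) (ENNReal.coe_pos.2 hε).ne'
  calc 1 = M.extension.runMeasure σ (Sum.inl p) (M.extension.win n) := h.symm
    _ ≤ M.extension.runMeasure σ (Sum.inl p) (⋃ N, M.winCount N K n) :=
        measure_mono fun ρ hρ => Set.mem_iUnion.2 (exists_mem_winCount hρ K)
    _ = ⨆ N, M.extension.runMeasure σ (Sum.inl p) (M.winCount N K n) :=
        (winCount_mono K n).measure_iUnion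
    _ ≤ M.val p n + ε :=
        iSup_le fun N => (runMeasure_winCount_le hK N).1 σ p K n n hK1 le_rfl (by omega)

end Extension

/-! ### Keeping the value at one -/

section Slack

variable {V : Type*} [Finite V] [MeasurableSpace V] [DiscreteMeasurableSpace V]
  {M : EnergyParityMDP V}

variable (M) in
/-- At the controlled state `s`, the value is still `1` with one unit of energy less than `n`. -/
def Slack (s : V) (n : ℤ) : Prop := s ∈ M.controlled ∧ M.Sure s (n - 1)

/-- Without slack, each controlled state has only one energy level of value `1`. Hence the moves
that lead from there to a value other than `1` lose a uniform amount. -/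
lemma exists_gap (M : EnergyParityMDP V) :
    ∃ η : ℝ≥0∞, η ≠ 0 ∧ η ≤ 1 ∧ ∀ s ∈ M.controlled, ∀ n t, M.Sure s n → ¬ M.Slack s n →
      ¬ M.Sure t (n + M.cost s t) → M.val t (n + M.cost s t) + η ≤ 1 := by
  have : ∀ x : V × V, ∃ η : ℝ≥0∞, η ≠ 0 ∧ η ≤ 1 ∧ ∀ n, M.Sure x.1 n → ¬ M.Sure x.1 (n - 1) →
      ¬ M.Sure x.2 (n + M.cost x.1 x.2) → M.val x.2 (n + M.cost x.1 x.2) + η ≤ 1 := by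
    rintro ⟨s, t⟩
    by_cases h : ∃ n, M.Sure s n ∧ ¬ M.Sure s (n - 1) ∧ ¬ M.Sure t (n + M.cost s t)
    · obtain ⟨n, h1, h2, h3⟩ := h
      have hlt : M.val t (n + M.cost s t) < 1 := lt_of_le_of_ne (val_le_one _ _) h3
      refine ⟨1 - M.val t (n + M.cost s t), (tsub_pos_of_lt hlt).ne', tsub_le_self,
        fun m h1' h2' _ => ?_⟩
      have : m = n := by
        by_contra hne
        rcases lt_or_gt_of_ne hne with hlt | hlt
        · exact h2 (h1'.mono (by omega))
        · exact h2' (h1.mono (by omega))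
      rw [this, add_tsub_cancel_of_le hlt.le]
    · exact ⟨1, one_ne_zero, le_rfl, fun n h1 h2 h3 => absurd ⟨n, h1, h2, h3⟩ h⟩
  choose f hf0 hf1 hf using this
  cases isEmpty_or_nonempty V with
  | inl hV => exact ⟨1, one_ne_zero, le_rfl, fun s => (hV.false s).elim⟩
  | inr hV =>
    obtain ⟨x, hx⟩ := Finite.exists_min f
    refine ⟨f x, hf0 x, hf1 x, fun s hs n t h1 h2 h3 => le_trans ?_
      (hf (s, t) n h1 (fun h => h2 ⟨hs, h⟩) h3)⟩
    gcongr
    exact hx _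

variable (M) in
/-- The runs that keep the value at `1` until they reach slack, and that reach slack or satisfy the
parity condition. -/
def phase (n : ℤ) : Set (ℕ → V) :=
  {ρ | (∀ i, (∀ j < i, ¬ M.Slack (ρ j) (M.level n ρ j)) → M.Sure (ρ i) (M.level n ρ i)) ∧
    ((∃ i, M.Slack (ρ i) (M.level n ρ i)) ∨ ρ ∈ M.parity)}

lemma sure_of_mem_phase {n : ℤ} {ρ : ℕ → V} (h : ρ ∈ M.phase n) : M.Sure (ρ 0) n := by
  simpa using h.1 0 (by simp)

lemma of_consRun_mem_phase {s : V} {n : ℤ} {ρ : ℕ → V} (hs : ¬ M.Slack s n)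
    (h : consRun s ρ ∈ M.phase n) : ρ ∈ M.phase (n + M.cost s (ρ 0)) := by
  refine ⟨fun i hi => ?_, h.2.imp ?_ (consRun_mem_parity s ρ).1⟩
  · rw [← level_consRun]
    refine h.1 (i + 1) fun j hj => ?_
    cases j with
    | zero => simpa using hs
    | succ j =>
      rw [level_consRun]
      exact hi j (Nat.lt_of_succ_lt_succ hj)
  · rintro ⟨i, hi⟩
    cases i with
    | zero => exact absurd (by simpa using hi) hs
    | succ i =>
      rw [level_consRun] at hi
      exact ⟨i, hi⟩

lemma measurableSet_phase (n : ℤ) : MeasurableSet (M.phase n) := by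
  have hpair : ∀ (P : V → ℤ → Prop) i,
      MeasurableSet {ρ : ℕ → V | P (ρ i) (M.level n ρ i)} := by
    intro P i
    have hm : Measurable fun ρ : ℕ → V => (ρ i, M.level n ρ i) :=
      (measurable_pi_apply i).prodMk (measurable_level n i)
    exact hm (MeasurableSet.of_discrete (s := {x : V × ℤ | P x.1 x.2}))
  have : M.phase n = (⋂ i, ({ρ | M.Sure (ρ i) (M.level n ρ i)} ∪
      ⋃ j ∈ Set.Iio i, {ρ | M.Slack (ρ j) (M.level n ρ j)})) ∩
      ((⋃ i, {ρ | M.Slack (ρ i) (M.level n ρ i)}) ∪ M.parity) := by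
    ext ρ
    simp only [phase, Set.mem_ofPred_eq, Set.mem_inter_iff, Set.mem_iInter, Set.mem_union,
      Set.mem_iUnion, Set.mem_Iio, exists_prop]
    refine and_congr_left fun _ => forall_congr' fun i => ?_
    constructor
    · intro h
      by_cases hj : ∀ j < i, ¬ M.Slack (ρ j) (M.level n ρ j)
      · exact .inl (h hj)
      · push Not at hj
        exact .inr hj
    · rintro (h | ⟨j, hj, h⟩) h'
      · exact h
      · exact absurd h (h' j hj)
  rw [this]
  refine .inter (.iInter fun i => (hpair M.Sure i).union
    (.biUnion (Set.to_countable _) fun j _ => hpair M.Slack j))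
    (.union (.iUnion fun i => hpair M.Slack i) measurableSet_parity)

variable (M) in
/-- The runs that, by time `N` and before they reach slack, give up the value `1`. -/
def leaving (N : ℕ) (n : ℤ) : Set (ℕ → V) :=
  {ρ | ∃ i ≤ N, ¬ M.Sure (ρ i) (M.level n ρ i) ∧ ∀ j < i, ¬ M.Slack (ρ j) (M.level n ρ j)}

lemma leaving_mono (n : ℤ) : Monotone fun N => M.leaving N n :=
  fun _ _ h _ ⟨i, hi, h'⟩ => ⟨i, hi.trans h, h'⟩

/-- Giving up the value `1` before slack is reached lowers the probability of winning by `η`. -/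
lemma runMeasure_win_add_leaving_le {η : ℝ≥0∞}
    (hη : ∀ s ∈ M.controlled, ∀ n t, M.Sure s n → ¬ M.Slack s n →
      ¬ M.Sure t (n + M.cost s t) → M.val t (n + M.cost s t) + η ≤ 1) (N : ℕ) :
    ∀ (σ : M.Strategy) (s : V) (n : ℤ), M.Sure s n →
      M.runMeasure σ s (M.win n) + η * M.runMeasure σ s (M.leaving N n) ≤ 1 := by
  induction N with
  | zero =>
    intro σ s n h
    rw [runMeasure_eq_zero σ s (A := M.leaving 0 n), mul_zero, add_zero]
    · exact prob_le_one
    · rintro ρ rfl ⟨i, hi, h', -⟩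
      obtain rfl := Nat.le_zero.1 hi
      exact h' (by simpa using h)
  | succ N ih =>
    intro σ s n h
    by_cases hs : M.Slack s n
    · rw [runMeasure_eq_zero σ s (A := M.leaving (N + 1) n), mul_zero, add_zero]
      · exact prob_le_one
      · rintro ρ rfl ⟨i, hi, h', hj⟩
        cases i with
        | zero => exact h' (by simpa using h)
        | succ i => exact hj 0 i.succ_pos (by simpa using hs)
    · have hle : M.runMeasure σ s (M.leaving (N + 1) n) ≤ ∑' t, M.next σ [] s t *
          M.runMeasure (σ.shift s) t (M.leaving N (n + M.cost s t)) := by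
        refine runMeasure_le_tsum σ s ?_
        rintro t - ρ rfl ⟨i, hi, h', hj⟩
        cases i with
        | zero => exact absurd (by simpa using h) h'
        | succ i =>
          refine ⟨i, Nat.le_of_succ_le_succ hi, by rwa [← level_consRun], fun j hji => ?_⟩
          rw [← level_consRun]
          exact hj (j + 1) (Nat.succ_lt_succ hji)
      rw [runMeasure_win_eq_tsum σ s h.nonneg]
      refine (add_le_add le_rfl (mul_le_mul_right hle η)).trans ?_
      calc _ = ∑' t, M.next σ [] s t * (M.runMeasure (σ.shift s) t (M.win (n + M.cost s t)) +
              η * M.runMeasure (σ.shift s) t (M.leaving N (n + M.cost s t))) := by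
            rw [← ENNReal.tsum_mul_left, ← ENNReal.tsum_add]
            refine tsum_congr fun t => ?_
            ring
        _ ≤ ∑' t, M.next σ [] s t * 1 := by
            refine ENNReal.tsum_le_tsum fun t => ?_
            by_cases ht : M.next σ [] s t = 0
            · simp [ht]
            refine mul_le_mul_right ?_ _
            by_cases hst : M.Sure t (n + M.cost s t)
            · exact ih _ _ _ hst
            · by_cases hC : s ∈ M.controlled
              · refine le_trans ?_ (hη s hC n t h hs hst)
                refine add_le_add (runMeasure_win_le_val _ _ _) ?_
                exact mul_le_of_le_one_right' prob_le_one
              · rw [next_prob σ [] hC] at ht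
                exact absurd (h.of_prob hC ht) hst
        _ = 1 := by simp [PMF.tsum_coe]

/-- A strategy with which the play from `s` with energy level `n` belongs, with high probability, to
a closed set of runs in `M.phase n`. -/
lemma Sure.exists_strategy_phase {s : V} {n : ℤ} (h : M.Sure s n) :
    ∃ (σ : M.Strategy) (K : Set (ℕ → V)), PrefixClosed K ∧ K ⊆ M.phase n ∧ (∀ ρ ∈ K, ρ 0 = s) ∧
      1 ≤ M.runMeasure σ s K + 3 / 4 := by
  obtain ⟨η, hη0, hη1, hη⟩ := exists_gap M
  have hηt : η ≠ ⊤ := (hη1.trans_lt ENNReal.one_lt_top).ne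
  have h4 : (4 : ℝ≥0∞)⁻¹ ≠ 0 := by simp
  -- A loss of `η / 4` bounds the probability of leaving by `1 / 4`. The losses of winning, of
  -- leaving and of the passage to a closed set then add up to at most `3 / 4`.
  obtain ⟨σ, hσ⟩ := exists_val_le_runMeasure_add (M := M) s n (mul_ne_zero hη0 h4)
  rw [h] at hσ
  have hleave : ∀ N, M.runMeasure σ s (M.leaving N n) ≤ 4⁻¹ := by
    intro N
    have h1 := (runMeasure_win_add_leaving_le hη N σ s n h).trans hσ
    have h2 := (ENNReal.add_le_add_iff_left (measure_ne_top _ _)).1 h1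
    exact (ENNReal.mul_le_mul_iff_right hη0 hηt).1 h2
  have hphase : M.runMeasure σ s (M.win n) ≤ M.runMeasure σ s (M.phase n) + 4⁻¹ := by
    have hsub : M.win n ⊆ M.phase n ∪ ⋃ N, M.leaving N n := by
      intro ρ hρ
      by_cases hD : ∃ N, ρ ∈ M.leaving N n
      · exact .inr (Set.mem_iUnion.2 hD)
      · refine .inl ⟨fun i hi => ?_, .inr hρ.2⟩
        by_contra hn
        exact hD ⟨i, i, le_rfl, hn, hi⟩
    refine (measure_mono hsub).trans ((measure_union_le _ _).trans ?_)
    gcongr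
    rw [(leaving_mono n).measure_iUnion]
    exact iSup_le hleave
  have hmeas : MeasurableSet ({ρ : ℕ → V | ρ 0 = s} ∩ M.phase n) :=
    (measurableSet_eq_fun (measurable_pi_apply 0) measurable_const).inter (measurableSet_phase n)
  obtain ⟨K, hK, hclosed, hμ⟩ := exists_prefixClosed_subset (μ := M.runMeasure σ s) hmeas h4
  refine ⟨σ, K, hclosed, fun ρ hρ => (hK hρ).2, fun ρ hρ => (hK hρ).1, ?_⟩
  have hη4 : η * 4⁻¹ ≤ 4⁻¹ := mul_le_of_le_one_left' hη1
  calc 1 ≤ M.runMeasure σ s (M.win n) + 4⁻¹ := hσ.trans (by gcongr)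
    _ ≤ M.runMeasure σ s (M.phase n) + 4⁻¹ + 4⁻¹ := by gcongr
    _ ≤ M.runMeasure σ s K + 4⁻¹ + 4⁻¹ + 4⁻¹ := by
        gcongr
        refine le_trans (runMeasure_mono σ s ?_) hμ
        exact fun ρ h0 h1 => ⟨h0, h1⟩
    _ = M.runMeasure σ s K + 3 / 4 := by
        rw [add_assoc, add_assoc, div_eq_mul_inv]
        congr 1
        ring

/-- The first move of `σ` can be modified so that it keeps the value at `1`, without decreasing the
probability of any move that does. -/
lemma Sure.exists_redirect {s : V} {n : ℤ} (h : M.Sure s n) (σ : M.Strategy) :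
    ∃ d : PMF V, (∀ t, d t ≠ 0 → M.edge s t ∧ M.Sure t (n + M.cost s t)) ∧
      (∀ hs : s ∉ M.controlled, d = M.prob ⟨s, hs⟩) ∧
      ∀ t, M.Sure t (n + M.cost s t) → M.next σ [] s t ≤ d t := by
  classical
  by_cases hs : s ∈ M.controlled
  · obtain ⟨t₀, he, hsure⟩ := h.exists_edge
    refine ⟨(M.next σ [] s).map fun t => if M.Sure t (n + M.cost s t) then t else t₀,
      fun t ht => ?_, fun hs' => absurd hs hs', fun t ht => ?_⟩
    · obtain ⟨t', ht', rfl⟩ := (PMF.mem_support_map_iff _ _ _).1 ((PMF.mem_support_iff _ _).2 ht)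
      split_ifs with h'
      · exact ⟨next_edge σ [] ((PMF.mem_support_iff _ _).1 ht'), h'⟩
      · exact ⟨he, hsure⟩
    · rw [PMF.map_apply]
      refine le_trans ?_ (ENNReal.le_tsum t)
      simp [ht]
  · refine ⟨M.prob ⟨s, hs⟩, fun t ht => ⟨M.prob_edge _ _ ht, h.of_prob hs ht⟩, fun _ => rfl,
      fun t _ => ?_⟩
    rw [next_prob σ [] hs]

end Slack

/-! ### The strategy in the extension -/

section Controller

variable {V : Type*} [Finite V] [MeasurableSpace V] [DiscreteMeasurableSpace V]
  {M : EnergyParityMDP V}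

/-- The continuations after the move from `s` to `t` of the runs in `K`. -/
def tailRuns (s t : V) (K : Set (ℕ → V)) : Set (ℕ → V) := {ρ | ρ 0 = t ∧ consRun s ρ ∈ K}

variable (M) in
/-- A plan for the state `s` and the energy level `n`: a strategy of `M`, to be followed for as long
as the play has a continuation in a certain closed set of runs, on which the strategy succeeds. -/
structure Plan (s : V) (n : ℤ) where
  /-- the strategy to follow -/
  strategy : M.Strategy
  /-- the runs on which the plan works out -/
  runs : Set (ℕ → V)
  nonempty : runs.Nonempty
  closed : PrefixClosed runs
  root : ∀ ρ ∈ runs, ρ 0 = s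
  subset : runs ⊆ M.phase n

lemma Plan.sure {s : V} {n : ℤ} (π : M.Plan s n) : M.Sure s n := by
  obtain ⟨ρ, hρ⟩ := π.nonempty
  exact π.root ρ hρ ▸ sure_of_mem_phase (π.subset hρ)

/-- The rest of a plan after the move to `t`. -/
def Plan.tail {s : V} {n : ℤ} (π : M.Plan s n) (hs : ¬ M.Slack s n) (t : V)
    (h : (tailRuns s t π.runs).Nonempty) : M.Plan t (n + M.cost s t) where
  strategy := π.strategy.shift s
  runs := tailRuns s t π.runs
  nonempty := h
  closed := by
    intro ρ hρ
    obtain ⟨ρ₁, ⟨h1, -⟩, h1'⟩ := hρ 0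
    refine ⟨(h1' 0 le_rfl).symm.trans h1, π.closed _ fun N => ?_⟩
    obtain ⟨ρ', hρ', heq⟩ := hρ N
    refine ⟨consRun s ρ', hρ'.2, fun i hi => ?_⟩
    cases i with
    | zero => rfl
    | succ i => exact heq i (Nat.le_of_succ_le hi)
  root := fun ρ hρ => hρ.1
  subset := by
    rintro ρ ⟨rfl, hρ⟩
    exact of_consRun_mem_phase hs (π.subset hρ)

lemma Sure.exists_plan {s : V} {n : ℤ} (h : M.Sure s n) :
    ∃ π : M.Plan s n, 1 ≤ M.runMeasure π.strategy s π.runs + 3 / 4 := by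
  obtain ⟨σ, K, hc, hp, hr, hμ⟩ := h.exists_strategy_phase
  refine ⟨⟨σ, K, ?_, hc, hr, hp⟩, hμ⟩
  by_contra hK
  rw [Set.not_nonempty_iff_eq_empty.1 hK, measure_empty, zero_add] at hμ
  exact absurd hμ (not_le.2 (ENNReal.div_lt_of_lt_mul (by norm_num)))

/-- A plan that works out with probability at least `1 / 4`. -/
noncomputable def Sure.plan {s : V} {n : ℤ} (h : M.Sure s n) : M.Plan s n := h.exists_plan.choose

lemma Sure.one_le_plan {s : V} {n : ℤ} (h : M.Sure s n) :
    1 ≤ M.runMeasure h.plan.strategy s h.plan.runs + 3 / 4 := h.exists_plan.choose_spec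

variable (M) in
/-- The memory of the strategy in the extension: it follows a plan, or it is about to return from a
new state. -/
inductive Memory
  | play (s : V) (n : ℤ) (π : M.Plan s n)
  | back (s : {s : V // s ∈ M.controlled ∧ M.limitValue s = 1}) (n : ℤ) (h : M.Sure s.1 n)

/-- The current state of the play. -/
def Memory.cur : M.Memory → M.ExtState
  | .play s _ _ => Sum.inl s
  | .back s _ _ => Sum.inr s

/-- The current energy level. -/
def Memory.lev : M.Memory → ℤ
  | .play _ n _ => n
  | .back _ n _ => n

lemma Memory.lev_nonneg (m : M.Memory) : 0 ≤ m.lev := by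
  cases m with
  | play s n π => exact π.sure.nonneg
  | back s n h => exact h.nonneg

/-- The strategies `τ m` of the extension, with the update function `u` of their memory, follow the
plan in the memory, redirected so that the value stays `1`. They start a new plan when the play has
no continuation in the runs of the present one. On reaching slack, they visit a new state. -/
structure IsController (τ : M.Memory → M.extension.Strategy)
    (u : M.Memory → M.ExtState → M.Memory) : Prop where
  shift : ∀ m x,
    M.extension.runMeasure ((τ m).shift m.cur) x = M.extension.runMeasure (τ (u m x)) x
  cur : ∀ m x, M.extension.next (τ m) [] m.cur x ≠ 0 → (u m x).cur = x
  lev : ∀ m x, M.extension.next (τ m) [] m.cur x ≠ 0 →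
    (u m x).lev = m.lev + M.extension.cost m.cur x
  slack : ∀ s n (π : M.Plan s n), M.Slack s n →
    ∀ t, M.extension.next (τ (.play s n π)) [] (.inl s) (.inl t) = 0
  le : ∀ s n (π : M.Plan s n), ¬ M.Slack s n → ∀ t, M.Sure t (n + M.cost s t) →
    M.next π.strategy [] s t ≤ M.extension.next (τ (.play s n π)) [] (.inl s) (.inl t)
  follow : ∀ s n (π : M.Plan s n) (hs : ¬ M.Slack s n) t (h : (tailRuns s t π.runs).Nonempty),
    u (.play s n π) (.inl t) = .play t (n + M.cost s t) (π.tail hs t h)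
  restart : ∀ s n (π : M.Plan s n), ¬ M.Slack s n → ∀ t, ¬ (tailRuns s t π.runs).Nonempty →
    M.extension.next (τ (.play s n π)) [] (.inl s) (.inl t) ≠ 0 →
    ∃ h : M.Sure t (n + M.cost s t), u (.play s n π) (.inl t) = .play t (n + M.cost s t) h.plan

lemma map_inl_apply {α β : Type*} (p : PMF α) (a : α) :
    p.map (Sum.inl : α → α ⊕ β) (Sum.inl a) = p a := by
  classical
  rw [PMF.map_apply, tsum_eq_single a]
  · simp
  · intro b hb
    simp [hb.symm]

lemma exists_isController (M : EnergyParityMDP V) :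
    ∃ (τ : M.Memory → M.extension.Strategy) (u : M.Memory → M.ExtState → M.Memory),
      IsController τ u := by
  classical
  have key : ∀ m : M.Memory, ∃ (d : PMF M.ExtState) (v : M.ExtState → M.Memory),
      (∀ x, d x ≠ 0 → M.extension.edge m.cur x) ∧
      (∀ h : m.cur ∉ M.extension.controlled, d = M.extension.prob ⟨m.cur, h⟩) ∧
      (∀ x, d x ≠ 0 → (v x).cur = x) ∧
      (∀ x, d x ≠ 0 → (v x).lev = m.lev + M.extension.cost m.cur x) ∧
      (∀ s n (π : M.Plan s n), m = .play s n π →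
        (M.Slack s n → ∀ t, d (.inl t) = 0) ∧
        (¬ M.Slack s n → ∀ t, M.Sure t (n + M.cost s t) →
          M.next π.strategy [] s t ≤ d (.inl t)) ∧
        (∀ (hs : ¬ M.Slack s n) t (h : (tailRuns s t π.runs).Nonempty),
          v (.inl t) = .play t (n + M.cost s t) (π.tail hs t h)) ∧
        (¬ M.Slack s n → ∀ t, ¬ (tailRuns s t π.runs).Nonempty → d (.inl t) ≠ 0 →
          ∃ h : M.Sure t (n + M.cost s t), v (.inl t) = .play t (n + M.cost s t) h.plan)) := by
    have hpure : ∀ {y x : M.ExtState}, PMF.pure y x ≠ 0 → x = y := by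
      intro y x h
      by_contra hne
      simp [PMF.pure_apply, hne] at h
    intro m
    match m with
    | .play s n π =>
      by_cases hs : M.Slack s n
      · refine ⟨PMF.pure (.inr ⟨s, hs.1, π.sure.limitValue⟩),
          fun _ => .back ⟨s, hs.1, π.sure.limitValue⟩ (n - 1) hs.2, ?_, ?_, ?_, ?_, ?_⟩
        · rintro x hx
          rw [hpure hx]
          exact rfl
        · exact fun h => absurd hs.1 h
        · rintro x hx
          rw [hpure hx]
          rfl
        · rintro x hx
          rw [hpure hx]
          rfl
        · rintro s' n' π' heq
          obtain ⟨rfl, rfl, heq⟩ := Memory.play.inj heq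
          refine ⟨fun _ t => by simp [PMF.pure_apply], fun h => absurd hs h,
            fun h => absurd hs h, fun h => absurd hs h⟩
      · obtain ⟨d, hd, hp, hle⟩ := π.sure.exists_redirect π.strategy
        let v : M.ExtState → M.Memory := Sum.elim (fun t =>
          if h : (tailRuns s t π.runs).Nonempty then .play t (n + M.cost s t) (π.tail hs t h)
          else if h : M.Sure t (n + M.cost s t) then .play t (n + M.cost s t) h.plan
          else .play s n π) fun _ => .play s n π
        have hv : ∀ t, M.Sure t (n + M.cost s t) → (v (.inl t)).cur = .inl t ∧
            (v (.inl t)).lev = n + M.cost s t := by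
          intro t ht
          simp only [v, Sum.elim_inl, dif_pos ht]
          split_ifs
          · exact ⟨rfl, rfl⟩
          · exact ⟨rfl, rfl⟩
        have hmap : ∀ x, d.map (Sum.inl : V → M.ExtState) x ≠ 0 → ∃ t, d t ≠ 0 ∧ Sum.inl t = x :=
          fun x hx => by
            obtain ⟨t, ht, rfl⟩ :=
              (PMF.mem_support_map_iff _ _ _).1 ((PMF.mem_support_iff _ _).2 hx)
            exact ⟨t, (PMF.mem_support_iff _ _).1 ht, rfl⟩
        refine ⟨d.map Sum.inl, v, ?_, ?_, ?_, ?_, ?_⟩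
        · intro x hx
          obtain ⟨t, ht, rfl⟩ := hmap x hx
          exact (hd t ht).1
        · exact fun h => congrArg (PMF.map Sum.inl) (hp h)
        · intro x hx
          obtain ⟨t, ht, rfl⟩ := hmap x hx
          exact (hv t (hd t ht).2).1
        · intro x hx
          obtain ⟨t, ht, rfl⟩ := hmap x hx
          exact (hv t (hd t ht).2).2
        · intro s' n' π' heq
          obtain ⟨rfl, rfl, heq⟩ := Memory.play.inj heq
          obtain rfl := eq_of_heq heq
          refine ⟨fun h => absurd h hs, fun _ t ht => ?_, fun _ t h => ?_, fun _ t h ht => ?_⟩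
          · rw [map_inl_apply]
            exact hle t ht
          · simp only [v, Sum.elim_inl, dif_pos h]
          · rw [map_inl_apply] at ht
            exact ⟨(hd t ht).2, by simp only [v, Sum.elim_inl, dif_neg h, dif_pos (hd t ht).2]⟩
    | .back s n h =>
      refine ⟨PMF.pure (.inl s.1), fun _ => .play s.1 n h.plan, ?_, ?_, ?_, ?_, ?_⟩
      · rintro x hx
        rw [hpure hx]
        exact rfl
      · exact fun h => absurd trivial h
      · rintro x hx
        rw [hpure hx]
        rfl
      · rintro x hx
        rw [hpure hx]
        exact (add_zero n).symm
      · rintro s' n' π' heq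
        cases heq
  choose a u ha hp hcur hlev hplay using key
  obtain ⟨τ, hτ⟩ := exists_strategy_of_automaton Memory.cur a u ha hp
  have hnext : ∀ m, M.extension.next (τ m) [] m.cur = a m := fun m => (hτ m).1
  refine ⟨τ, u, fun m x => (hτ m).2 x, fun m => ?_, fun m => ?_, fun s n π => ?_, fun s n π => ?_,
    fun s n π => (hplay _ s n π rfl).2.2.1, fun s n π => ?_⟩
  · rw [hnext]
    exact hcur m
  · rw [hnext]
    exact hlev m
  · have := hnext (.play s n π)
    rw [Memory.cur] at this
    rw [this]
    exact (hplay _ s n π rfl).1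
  · have := hnext (.play s n π)
    rw [Memory.cur] at this
    rw [this]
    exact (hplay _ s n π rfl).2.1
  · have := hnext (.play s n π)
    rw [Memory.cur] at this
    rw [this]
    exact (hplay _ s n π rfl).2.2.2

end Controller

/-! ### The strategy wins almost surely -/

section Analysis

variable {V : Type*} [Finite V] [MeasurableSpace V] [DiscreteMeasurableSpace V]
  {M : EnergyParityMDP V} {τ : M.Memory → M.extension.Strategy}
  {u : M.Memory → M.ExtState → M.Memory}

lemma IsController.runMeasure_le_tsum (hτ : IsController τ u) (m : M.Memory)
    {A : Set (ℕ → M.ExtState)} {B : M.ExtState → Set (ℕ → M.ExtState)}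
    (h : ∀ x, M.extension.next (τ m) [] m.cur x ≠ 0 →
      ∀ ρ, ρ 0 = x → consRun m.cur ρ ∈ A → ρ ∈ B x) :
    M.extension.runMeasure (τ m) m.cur A ≤ ∑' x, M.extension.next (τ m) [] m.cur x *
      M.extension.runMeasure (τ (u m x)) (u m x).cur (B x) := by
  refine (EnergyParityMDP.runMeasure_le_tsum (τ m) m.cur h).trans
    (ENNReal.tsum_le_tsum fun x => ?_)
  by_cases hx : M.extension.next (τ m) [] m.cur x = 0
  · simp [hx]
  · rw [hτ.shift, hτ.cur m x hx]

/-- If an event, one step later, is contained in an event of probability `0`, then it has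
probability `0`. -/
lemma IsController.runMeasure_eq_zero (hτ : IsController τ u) (m : M.Memory)
    {A : Set (ℕ → M.ExtState)} {B : M.ExtState → Set (ℕ → M.ExtState)}
    (h : ∀ x, M.extension.next (τ m) [] m.cur x ≠ 0 →
      ∀ ρ, ρ 0 = x → consRun m.cur ρ ∈ A → ρ ∈ B x)
    (h0 : ∀ x, M.extension.next (τ m) [] m.cur x ≠ 0 →
      M.extension.runMeasure (τ (u m x)) (u m x).cur (B x) = 0) :
    M.extension.runMeasure (τ m) m.cur A = 0 := by
  refine le_antisymm ((hτ.runMeasure_le_tsum m h).trans ?_) zero_le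
  refine (ENNReal.tsum_eq_zero.2 fun x => ?_).le
  by_cases hx : M.extension.next (τ m) [] m.cur x = 0
  · simp [hx]
  · simp [h0 x hx]

lemma IsController.runMeasure_level_neg (hτ : IsController τ u) (m : M.Memory) :
    M.extension.runMeasure (τ m) m.cur {ρ | ∃ i, M.extension.level m.lev ρ i < 0} = 0 := by
  have key : ∀ (N : ℕ) (m : M.Memory), M.extension.runMeasure (τ m) m.cur
      {ρ | ∃ i ≤ N, M.extension.level m.lev ρ i < 0} = 0 := by
    intro N
    induction N with
    | zero =>
      refine fun m => EnergyParityMDP.runMeasure_eq_zero _ _ ?_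
      rintro ρ - ⟨i, hi, h⟩
      rw [Nat.le_zero.1 hi, level_zero] at h
      exact absurd m.lev_nonneg (not_le.2 h)
    | succ N ih =>
      refine fun m => hτ.runMeasure_eq_zero m
        (B := fun x => {ρ | ∃ i ≤ N, M.extension.level (u m x).lev ρ i < 0}) ?_ fun x _ => ih _
      rintro x hx ρ rfl ⟨i, hi, h⟩
      cases i with
      | zero =>
        rw [level_zero] at h
        exact absurd m.lev_nonneg (not_le.2 h)
      | succ i =>
        refine ⟨i, Nat.le_of_succ_le_succ hi, ?_⟩
        rwa [hτ.lev m _ hx, ← level_consRun]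
  have : {ρ | ∃ i, M.extension.level m.lev ρ i < 0} =
      ⋃ N, {ρ | ∃ i ≤ N, M.extension.level m.lev ρ i < 0} := by
    ext ρ
    simp only [Set.mem_ofPred_eq, Set.mem_iUnion]
    exact ⟨fun ⟨i, h⟩ => ⟨i, i, le_rfl, h⟩, fun ⟨_, i, _, h⟩ => ⟨i, h⟩⟩
  rw [this]
  exact measure_iUnion_null fun N => key N m

variable (M) in
/-- The runs that never visit a new state and violate the parity condition. -/
def failing : Set (ℕ → M.ExtState) := M.noNew ∩ M.extension.parityᶜ

lemma consRun_mem_noNew {x : M.ExtState} {ρ : ℕ → M.ExtState} :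
    consRun x ρ ∈ M.noNew ↔ x.isLeft ∧ ρ ∈ M.noNew := by
  constructor
  · exact fun h => ⟨h 0, fun i => h (i + 1)⟩
  · rintro ⟨h0, h⟩ i
    cases i with
    | zero => exact h0
    | succ i => exact h i

lemma consRun_mem_failing {x : M.ExtState} {ρ : ℕ → M.ExtState} :
    consRun x ρ ∈ M.failing ↔ x.isLeft ∧ ρ ∈ M.failing := by
  simp only [failing, Set.mem_inter_iff, consRun_mem_noNew, Set.mem_compl_iff, consRun_mem_parity,
    and_assoc]

/-- The runs of the extension whose underlying run in `M`, by time `N`, reaches slack or has a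
prefix that is not a prefix of a run in `K`. Meant for runs without new states. -/
def stopped (N : ℕ) (n : ℤ) (K : Set (ℕ → V)) : Set (ℕ → M.ExtState) :=
  {ρ | ∃ i ≤ N, M.Slack (base (ρ i)) (M.level n (fun i => base (ρ i)) i) ∨
    ∀ ρ' ∈ K, ∃ j ≤ i, ρ' j ≠ base (ρ j)}

lemma stopped_mono (n : ℤ) (K : Set (ℕ → V)) : Monotone fun N => stopped (M := M) N n K :=
  fun _ _ h _ ⟨i, hi, h'⟩ => ⟨i, hi.trans h, h'⟩

lemma base_consRun (x : M.ExtState) (ρ : ℕ → M.ExtState) :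
    (fun i => base (consRun x ρ i)) = consRun (base x) fun i => base (ρ i) := by
  funext i
  cases i <;> rfl

lemma Plan.of_consRun_mem_stopped {s : V} {n : ℤ} (π : M.Plan s n) (hs : ¬ M.Slack s n) {N : ℕ}
    {ρ : ℕ → M.ExtState} (h : consRun (Sum.inl s) ρ ∈ stopped (N + 1) n π.runs) :
    ρ ∈ stopped N (n + M.cost s (base (ρ 0))) (tailRuns s (base (ρ 0)) π.runs) := by
  obtain ⟨i, hi, h⟩ := h
  rw [base_consRun] at h
  cases i with
  | zero =>
    rcases h with h | h
    · rw [level_zero] at h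
      exact absurd h hs
    · obtain ⟨ρ', hρ'⟩ := π.nonempty
      obtain ⟨j, hj, hne⟩ := h ρ' hρ'
      rw [Nat.le_zero.1 hj] at hne
      exact absurd (π.root ρ' hρ') hne
  | succ i =>
    refine ⟨i, Nat.le_of_succ_le_succ hi, h.imp (fun h => ?_) fun h ρ' hρ' => ?_⟩
    · rwa [level_consRun] at h
    · obtain ⟨j, hj, hne⟩ := h _ hρ'.2
      cases j with
      | zero => exact absurd rfl hne
      | succ j => exact ⟨j, Nat.le_of_succ_le_succ hj, hne⟩

/-- A failing run does not stay within the runs of a plan without reaching slack. -/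
lemma Plan.exists_mem_stopped {s : V} {n : ℤ} (π : M.Plan s n) {ρ : ℕ → M.ExtState}
    (h : ρ ∈ M.failing) : ∃ N, ρ ∈ stopped N n π.runs := by
  by_contra! hn
  have hmem : (fun i => base (ρ i)) ∈ π.runs := by
    refine π.closed _ fun N => ?_
    by_contra! hN
    exact hn N ⟨N, le_rfl, .inr hN⟩
  rcases (π.subset hmem).2 with ⟨i, hi⟩ | hp
  · exact hn i ⟨i, le_rfl, .inl hi⟩
  · exact h.2 ((parity_base h.1).1 hp)

lemma IsController.runMeasure_failing_of_slack (hτ : IsController τ u) {s : V} {n : ℤ}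
    (π : M.Plan s n)
    (hs : M.Slack s n) :
    M.extension.runMeasure (τ (.play s n π)) (.inl s) M.failing = 0 := by
  refine hτ.runMeasure_eq_zero (.play s n π) (B := fun _ => ∅) ?_ fun _ _ => measure_empty
  rintro x hx ρ rfl h
  have hx' := (consRun_mem_failing.1 h).2.1 0
  rw [eq_inl_base hx'] at hx
  exact hx (hτ.slack s n π hs _)

variable (τ) in
/-- The worst probability of failing, over the memory states in which a new plan starts. -/
noncomputable def failBound : ℝ≥0∞ :=
  ⨆ (s : V) (n : ℤ) (h : M.Sure s n),
    M.extension.runMeasure (τ (.play s n h.plan)) (.inl s) M.failing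

lemma runMeasure_failing_le_failBound {s : V} {n : ℤ} (h : M.Sure s n) :
    M.extension.runMeasure (τ (.play s n h.plan)) (.inl s) M.failing ≤ failBound τ :=
  le_iSup_of_le s (le_iSup_of_le n (le_iSup (fun h : M.Sure s n =>
    M.extension.runMeasure (τ (.play s n h.plan)) (.inl s) M.failing) h))

/-- While a plan is followed, the play fails only if it leaves the runs of the plan, and then a new
plan starts, which fails with probability at most `failBound τ`. -/
lemma IsController.failing_inter_stopped_add_le (hτ : IsController τ u) (N : ℕ) :
    ∀ (s : V) (n : ℤ) (π : M.Plan s n),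
      M.extension.runMeasure (τ (.play s n π)) (.inl s) (M.failing ∩ stopped N n π.runs) +
        failBound τ * M.runMeasure π.strategy s π.runs ≤ failBound τ := by
  have hslack : ∀ N s n (π : M.Plan s n), M.Slack s n →
      M.extension.runMeasure (τ (.play s n π)) (.inl s) (M.failing ∩ stopped N n π.runs) +
        failBound τ * M.runMeasure π.strategy s π.runs ≤ failBound τ := by
    intro N s n π hs
    rw [measure_mono_null Set.inter_subset_left (hτ.runMeasure_failing_of_slack π hs), zero_add]
    exact mul_le_of_le_one_right' prob_le_one
  induction N with
  | zero =>
    intro s n π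
    by_cases hs : M.Slack s n
    · exact hslack 0 s n π hs
    rw [EnergyParityMDP.runMeasure_eq_zero, zero_add]
    · exact mul_le_of_le_one_right' prob_le_one
    · rintro ρ h0 ⟨-, i, hi, h⟩
      obtain rfl := Nat.le_zero.1 hi
      rcases h with h | h
      · rw [level_zero, h0] at h
        exact hs h
      · obtain ⟨ρ', hρ'⟩ := π.nonempty
        obtain ⟨j, hj, hne⟩ := h ρ' hρ'
        rw [Nat.le_zero.1 hj, h0, π.root ρ' hρ'] at hne
        exact hne rfl
  | succ N ih =>
    intro s n π
    by_cases hs : M.Slack s n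
    · exact hslack _ s n π hs
    set b := failBound τ with hb
    set m : M.Memory := .play s n π with hm
    let d : V → ℝ≥0∞ := fun t => M.extension.next (τ m) [] (.inl s) (.inl t)
    let φ : V → ℝ≥0∞ := fun t => M.extension.runMeasure (τ (u m (.inl t))) (u m (.inl t)).cur
      (M.failing ∩ stopped N (n + M.cost s t) (tailRuns s t π.runs))
    let ψ : V → ℝ≥0∞ := fun t => M.runMeasure (π.strategy.shift s) t (tailRuns s t π.runs)
    have h1 : M.extension.runMeasure (τ m) (.inl s) (M.failing ∩ stopped (N + 1) n π.runs) ≤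
        ∑' t, d t * φ t := by
      refine (hτ.runMeasure_le_tsum m (B := fun x => if x.isLeft then M.failing ∩
        stopped N (n + M.cost s (base x)) (tailRuns s (base x) π.runs) else ∅) ?_).trans ?_
      · rintro x - ρ rfl ⟨hf, hst⟩
        have hf' := (consRun_mem_failing.1 hf).2
        simp only [if_pos (hf'.1 0)]
        exact ⟨hf', π.of_consRun_mem_stopped hs hst⟩
      · rw [← Function.Injective.tsum_eq (g := Sum.inl) Sum.inl_injective]
        · rfl
        · intro x hx
          cases x with
          | inl t => exact ⟨t, rfl⟩
          | inr t => simp at hx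
    have h2 : M.runMeasure π.strategy s π.runs ≤ ∑' t, M.next π.strategy [] s t * ψ t :=
      EnergyParityMDP.runMeasure_le_tsum _ _ fun t _ ρ h0 h => ⟨h0, h⟩
    have h3 : ∀ t, d t * φ t + b * (M.next π.strategy [] s t * ψ t) ≤ d t * b := by
      intro t
      by_cases ht : (tailRuns s t π.runs).Nonempty
      -- The plan is still followed, so the move is sure and redirection made it no less likely.
      · have hle : M.next π.strategy [] s t ≤ d t :=
          hτ.le s n π hs t (π.tail hs t ht).sure
        have hih : φ t + b * ψ t ≤ b := by
          have := ih t (n + M.cost s t) (π.tail hs t ht)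
          simp only [φ, hm, hτ.follow s n π hs t ht]
          exact this
        calc d t * φ t + b * (M.next π.strategy [] s t * ψ t)
            ≤ d t * φ t + b * (d t * ψ t) := by gcongr
          _ = d t * (φ t + b * ψ t) := by ring
          _ ≤ d t * b := by gcongr
      -- The play leaves the runs of the plan: these contribute nothing, and a new plan starts.
      · have hψ : ψ t = 0 := by
          simp only [ψ, Set.not_nonempty_iff_eq_empty.1 ht, measure_empty]
        rw [hψ, mul_zero, mul_zero, add_zero]
        by_cases hd : d t = 0
        · simp [hd]
        obtain ⟨h, hu⟩ := hτ.restart s n π hs t ht hd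
        refine mul_le_mul_right ?_ _
        simp only [φ, hm, hu]
        exact (measure_mono Set.inter_subset_left).trans (runMeasure_failing_le_failBound h)
    calc _ ≤ ∑' t, d t * φ t + b * ∑' t, M.next π.strategy [] s t * ψ t := by gcongr
      _ = ∑' t, (d t * φ t + b * (M.next π.strategy [] s t * ψ t)) := by
          rw [ENNReal.tsum_add, ENNReal.tsum_mul_left]
      _ ≤ ∑' t, d t * b := ENNReal.tsum_le_tsum h3
      _ = (∑' t, d t) * b := ENNReal.tsum_mul_right
      _ ≤ 1 * b := by
          gcongr
          exact (ENNReal.tsum_comp_le_tsum_of_injective Sum.inl_injective _).trans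
            (PMF.tsum_coe _).le
      _ = b := one_mul b

lemma IsController.failing_add_le (hτ : IsController τ u) {s : V} {n : ℤ} (π : M.Plan s n) :
    M.extension.runMeasure (τ (.play s n π)) (.inl s) M.failing +
      failBound τ * M.runMeasure π.strategy s π.runs ≤ failBound τ := by
  have hsub : M.failing ⊆ ⋃ N, M.failing ∩ stopped N n π.runs := fun ρ hρ =>
    Set.mem_iUnion.2 ((π.exists_mem_stopped hρ).imp fun _ h => ⟨hρ, h⟩)
  have hmono : Monotone fun N => M.failing ∩ stopped N n π.runs :=
    fun _ _ h => Set.inter_subset_inter_right _ (stopped_mono n π.runs h)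
  refine (add_le_add (measure_mono hsub) le_rfl).trans ?_
  rw [hmono.measure_iUnion, ENNReal.iSup_add]
  exact iSup_le fun N => hτ.failing_inter_stopped_add_le N s n π

/-- As each new plan works out with probability at least `1 / 4`, the bound `b` on the probability
of failing satisfies `b ≤ (3 / 4) * b`. -/
lemma IsController.failBound_eq_zero (hτ : IsController τ u) : failBound τ = 0 := by
  set b := failBound τ with hb
  have hb1 : b ≤ 1 := iSup_le fun _ => iSup_le fun _ => iSup_le fun _ => prob_le_one
  have hbt : b ≠ ⊤ := (hb1.trans_lt ENNReal.one_lt_top).ne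
  have hle : b ≤ b * (3 / 4) := by
    refine iSup_le fun s => iSup_le fun n => iSup_le fun h => ?_
    have h1 := hτ.failing_add_le h.plan
    have h2 : b ≤ b * (3 / 4) + b * M.runMeasure h.plan.strategy s h.plan.runs := by
      calc b = b * 1 := (mul_one b).symm
        _ ≤ b * (M.runMeasure h.plan.strategy s h.plan.runs + 3 / 4) := by
            gcongr
            exact h.one_le_plan
        _ = _ := by rw [mul_add, add_comm]
    exact (ENNReal.add_le_add_iff_right
      (ENNReal.mul_ne_top hbt (measure_ne_top _ _))).1 (h1.trans h2)
  by_contra h0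
  have hlt : b * (3 / 4) < b * 1 :=
    (ENNReal.mul_lt_mul_iff_right h0 hbt).2 (ENNReal.div_lt_of_lt_mul (by norm_num))
  rw [mul_one] at hlt
  exact absurd hle (not_le.2 hlt)

lemma IsController.runMeasure_failing (hτ : IsController τ u) (m : M.Memory) :
    M.extension.runMeasure (τ m) m.cur M.failing = 0 := by
  cases m with
  | play s n π =>
    have h := hτ.failing_add_le π
    rw [hτ.failBound_eq_zero, zero_mul, add_zero] at h
    exact le_antisymm h zero_le
  | back s n h =>
    refine EnergyParityMDP.runMeasure_eq_zero _ _ fun ρ h0 hρ => ?_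
    have := hρ.1 0
    rw [h0] at this
    exact absurd this (by simp [Memory.cur])

/-- After the last visit to a new state, the play almost surely satisfies the parity condition. -/
lemma IsController.runMeasure_eventually_isLeft_inter (hτ : IsController τ u) (N : ℕ) :
    ∀ m : M.Memory, M.extension.runMeasure (τ m) m.cur
      ({ρ | ∀ i ≥ N, (ρ i).isLeft} ∩ M.extension.parityᶜ) = 0 := by
  induction N with
  | zero =>
    refine fun m => measure_mono_null ?_ (hτ.runMeasure_failing m)
    exact fun ρ hρ => ⟨fun i => hρ.1 i zero_le, hρ.2⟩
  | succ N ih =>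
    refine fun m => hτ.runMeasure_eq_zero m
      (B := fun _ => {ρ | ∀ i ≥ N, (ρ i).isLeft} ∩ M.extension.parityᶜ) ?_ fun x _ => ih _
    rintro x - ρ - ⟨h1, h2⟩
    exact ⟨fun i hi => h1 (i + 1) (Nat.succ_le_succ hi),
      fun h => h2 ((consRun_mem_parity _ _).2 h)⟩

/-- Infinitely many visits to new states, which have priority `0`, ensure the parity condition. -/
lemma mem_parity_of_frequently {ρ : ℕ → M.ExtState} (h : ∃ᶠ i in atTop, (ρ i).isRight) :
    ρ ∈ M.extension.parity := by
  refine ⟨0, ⟨h.mono fun i hi => ?_, fun _ _ => Nat.zero_le _⟩, .zero⟩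
  cases hx : ρ i with
  | inl s => simp [hx] at hi
  | inr s => rfl

lemma IsController.runMeasure_win (hτ : IsController τ u) (m : M.Memory) :
    M.extension.runMeasure (τ m) m.cur (M.extension.win m.lev) = 1 := by
  rw [← prob_compl_eq_zero_iff (measurableSet_win _)]
  refine measure_mono_null (t := {ρ | ∃ i, M.extension.level m.lev ρ i < 0} ∪
    ⋃ N, {ρ | ∀ i ≥ N, (ρ i).isLeft} ∩ M.extension.parityᶜ) (fun ρ hρ => ?_) ?_
  · by_contra hn
    simp only [Set.mem_union, Set.mem_iUnion, Set.mem_inter_iff, Set.mem_ofPred_eq,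
      Set.mem_compl_iff, not_or, not_exists, not_lt] at hn
    refine hρ ⟨hn.1, ?_⟩
    by_contra hpar
    refine hpar (mem_parity_of_frequently (Filter.frequently_atTop.2 fun N => ?_))
    by_contra! hN
    exact hn.2 N ⟨fun i hi => by simpa using hN i hi, hpar⟩
  · exact measure_union_null (hτ.runMeasure_level_neg m)
      (measure_iUnion_null fun N => hτ.runMeasure_eventually_isLeft_inter N m)

end Analysis

end EnergyParityMDP

theorem theorem7 {V : Type*} [Finite V] [MeasurableSpace V] [DiscreteMeasurableSpace V]
    (M : EnergyParityMDP V) (p : V) (k : ℕ) :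
    M.value p (M.energy k ∩ M.parity) = 1 ↔
      ∃ σ : M.extension.Strategy,
        M.extension.runMeasure σ (Sum.inl p) (M.extension.energy k ∩ M.extension.parity) = 1 := by
  rw [EnergyParityMDP.energy_inter_parity, EnergyParityMDP.energy_inter_parity]
  constructor
  · intro h
    have hsure : M.Sure p k := h
    obtain ⟨τ, u, hτ⟩ := EnergyParityMDP.exists_isController M
    exact ⟨_, hτ.runMeasure_win (.play p k hsure.plan)⟩
  · rintro ⟨σ, h⟩
    exact EnergyParityMDP.sure_of_runMeasure_extension h
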